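/- Let $p\ge 5$ be a prime. For $F=\sum_{h\ge -m} f_hX^{-h}\in\mathbf F_p((X^{-1}))$ with $f_{-m}\neq 0$ put $|F|=2^m$, put $|0|=0$, and let $\|F\|$ be the norm of the fractional part of $F$ (the part of the series with the negative powers of $X$). Call $F$ badly approximable if $\inf_{q}|q|\cdot\|qF\|>0$, the infimum being over the non-zero $q\in\mathbf F_p[X]$. Say that a pair $(\Theta,\Phi)$ satisfies the Littlewood conjecture non-trivially if $$\inf_{q\in\mathbf F_p[X]\setminus\{0\}}|q|\cdot\|q\Theta\|\cdot\|q\Phi\|=0,$$ both $\Theta$ and $\Phi$ are badly approximable, and $1,\Theta,\Phi$ are linearly independent over $\mathbf F_p[X]$. Continued fractions $[a_0,a_1,a_2,\ldots]$ are taken with respect to polynomial parts. For $k\ge 0$ let $L_k(3)$ be the word consisting of $(p^k-1)/2$ copies of $X/3,\,3X$, and let $L_k(-1)$ be the word consisting of $(p^k-1)/2$ copies of $-X,\,-X$ (both are empty for $k=0$). For $k\ge 1$ let $f_k=\sum_{0\le 2j\le k}\binom{k-j}{j}X^{k-2j}\in\mathbf F_p[X]$. **Theorem 8.** There are a unique series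 $\Theta_p\in\mathbf F_p((X^{-1}))$ with the continued fraction expansion $$\Theta_p=[X,L_0(3),-X/3,L_0(-1),X,L_1(3),-X/3,L_1(-1),X,L_2(3),-X/3,L_2(-1),\ldots]$$ and a unique series $\Phi_p\in\mathbf F_p((X^{-1}))$ with the continued fraction expansion $$\Phi_p=[3X,X/3,3X,X/3,3X,\ldots].$$ The series $\Theta_p$ is a root of the polynomial $$XZ^{p+1}-(X^2-3)Z^p+(Xf_{p-2}-3f_{p-1})Z-f_{p-2}(X^2-3)+3f_{p-1}X$$ and is algebraic of degree $p+1$ over $\mathbf F_p(X)$; the series $\Phi_p$ is algebraic of degree $2$ over $\mathbf F_p(X)$. The pair $(\Theta_p,\Phi_p)$ satisfies the Littlewood conjecture non-trivially. -/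

import Mathlib

open Polynomial

/-! The field `K((X⁻¹))` is modelled as `LaurentSeries K`, the Laurent series in `T = X⁻¹`:
the coefficient of `T ^ i` is the coefficient of `X ^ (-i)`. -/

section General

variable {K : Type*} [Field K]

/-- The embedding of `K[X]` in `K((X⁻¹))`, sending `X` to `T⁻¹`. -/
noncomputable def polyEmb : K[X] →+* LaurentSeries K :=
  Polynomial.eval₂RingHom HahnSeries.C (HahnSeries.single (-1 : ℤ) (1 : K))

open Classical in
/-- The norm `|F|`: `|0| = 0`, and `|F| = 2 ^ m` if `X ^ m` is the highest power of `X` that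
occurs in `F` (so that `m` is minus the order of `F` in `T`). -/
noncomputable def absVal (F : LaurentSeries K) : ℝ :=
  if F = 0 then 0 else (2 : ℝ) ^ (-F.order)

/-- The polynomial part of `F`: the part of the series with the powers `X ^ i`, `i ≥ 0`. -/
noncomputable def polyPart (F : LaurentSeries K) : K[X] :=
  ∑ i ∈ Finset.range ((-F.order).toNat + 1), Polynomial.monomial i (F.coeff (-(i : ℤ)))

/-- The fractional part of `F`: the part of the series with the negative powers of `X`. -/
noncomputable def fracPart (F : LaurentSeries K) : LaurentSeries K :=
  F - polyEmb (polyPart F)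

/-- `‖F‖`, the norm of the fractional part of `F`. -/
noncomputable def fracNorm (F : LaurentSeries K) : ℝ :=
  absVal (fracPart F)

/-- `F` is badly approximable: `inf |q| ‖q F‖ > 0` over the nonzero polynomials `q`. -/
def BadlyApproximable (F : LaurentSeries K) : Prop :=
  0 < ⨅ q : {q : K[X] // q ≠ 0}, absVal (polyEmb q.1) * fracNorm (polyEmb q.1 * F)

/-- The pair satisfies the Littlewood conjecture:
`inf |q| ‖q Θ‖ ‖q Φ‖ = 0` over the nonzero polynomials `q`. -/
def Littlewood (Θ Φ : LaurentSeries K) : Prop :=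
  ⨅ q : {q : K[X] // q ≠ 0},
    absVal (polyEmb q.1) * fracNorm (polyEmb q.1 * Θ) * fracNorm (polyEmb q.1 * Φ) = 0

/-- `1`, `Θ`, `Φ` are linearly independent over `K[X]`. -/
def OneLinIndep (Θ Φ : LaurentSeries K) : Prop :=
  ∀ a b c : K[X], polyEmb a + polyEmb b * Θ + polyEmb c * Φ = 0 → a = 0 ∧ b = 0 ∧ c = 0

/-- The pair satisfies the Littlewood conjecture non-trivially: both series are badly
approximable, and `1`, `Θ`, `Φ` are linearly independent over `K[X]`. -/
def LittlewoodNontrivially (Θ Φ : LaurentSeries K) : Prop :=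
  Littlewood Θ Φ ∧ BadlyApproximable Θ ∧ BadlyApproximable Φ ∧ OneLinIndep Θ Φ

/-- The complete quotients of the continued fraction algorithm:
`F₀ = F` and `Fₙ₊₁ = 1 / (Fₙ - aₙ)`, with `aₙ` the polynomial part of `Fₙ`. -/
noncomputable def completeQuotient (F : LaurentSeries K) : ℕ → LaurentSeries K
  | 0 => F
  | n + 1 => (fracPart (completeQuotient F n))⁻¹

/-- `F = [a₀, a₁, a₂, …]`: the continued fraction algorithm applied to `F` never stops, and its
partial quotients are the `aₙ`. -/
def HasContFrac (F : LaurentSeries K) (a : ℕ → K[X]) : Prop :=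
  ∀ n, fracPart (completeQuotient F n) ≠ 0 ∧ polyPart (completeQuotient F n) = a n

/-- `F` is algebraic over `K(X)`, of degree `d`: `d` is the least degree (in the outer variable)
of a nonzero polynomial over `K[X]` that vanishes at `F`. -/
def HasAlgDegree (F : LaurentSeries K) (d : ℕ) : Prop :=
  IsLeast {n : ℕ | ∃ P : K[X][X], P ≠ 0 ∧ P.eval₂ polyEmb F = 0 ∧ P.natDegree = n} d

end General

section MillsRobbins

variable (p : ℕ) [Fact p.Prime]

/-- `f_k = ∑_{0 ≤ 2j ≤ k} (k-j choose j) X ^ (k - 2j)` in `F_p[X]`. -/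
noncomputable def mrF (k : ℕ) : (ZMod p)[X] :=
  ∑ j ∈ Finset.range (k / 2 + 1), C (((k - j).choose j : ℕ) : ZMod p) * X ^ (k - 2 * j)

/-- The polynomial `X Z^(p+1) - (X^2 - 3) Z^p + (X f_(p-2) - 3 f_(p-1)) Z
- f_(p-2) (X^2 - 3) + 3 f_(p-1) X`; the outer variable is `Z`. -/
noncomputable def mrPoly : (ZMod p)[X][X] :=
  C (X : (ZMod p)[X]) * X ^ (p + 1) - C (X ^ 2 - 3 : (ZMod p)[X]) * X ^ p
    + C (X * mrF p (p - 2) - 3 * mrF p (p - 1)) * X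
    + C (-(mrF p (p - 2) * (X ^ 2 - 3)) + 3 * mrF p (p - 1) * X)

/-- The polynomial `X / 3` of `F_p[X]`. -/
noncomputable def xDivThree : (ZMod p)[X] := C ((3 : ZMod p)⁻¹) * X

/-- The word `L_k(3)`: `(p^k - 1) / 2` copies of `X/3, 3X`. -/
noncomputable def wordLThree (k : ℕ) : List ((ZMod p)[X]) :=
  (List.replicate ((p ^ k - 1) / 2) [xDivThree p, 3 * X]).flatten

/-- The word `L_k(-1)`: `(p^k - 1) / 2` copies of `-X, -X`. -/
noncomputable def wordLNegOne (k : ℕ) : List ((ZMod p)[X]) :=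
  (List.replicate ((p ^ k - 1) / 2) [-X, -X]).flatten

/-- The word `X, L_k(3), -X/3, L_k(-1)`. -/
noncomputable def thetaBlock (k : ℕ) : List ((ZMod p)[X]) :=
  X :: (wordLThree p k ++ (-xDivThree p) :: wordLNegOne p k)

/-- The infinite word obtained by concatenating the blocks `0, 1, 2, …`. Its letter with index `n`
is read off the first `n + 1` blocks, whose concatenation has at least `2 (n + 1)` letters, so
that the default value `0` is never used. -/
noncomputable def thetaQuotients (n : ℕ) : (ZMod p)[X] :=
  ((List.range (n + 1)).flatMap (thetaBlock p)).getD n 0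

/-- The sequence `3X, X/3, 3X, X/3, …`. -/
noncomputable def phiQuotients (n : ℕ) : (ZMod p)[X] :=
  if Even n then 3 * X else xDivThree p

end MillsRobbins

/-! ### The norm on K((X⁻¹)), polynomial and fractional parts, completeness. -/

section Valuation

variable {K : Type*} [Field K]

/-! All partial quotients have degree 1. So both expansions converge and determine their series, and
|q|·‖qF‖ ≥ 1/2 for every nonzero q (`HasContFrac.one_half_le`).

The equation of Θ comes from the Frobenius. Let M be the matrix of X, N that of X^p, B_k that of
block k, and D = !![1, f_{p-2}; 0, f_{p-1}]. Since M² = XM + 1, in characteristic p the matrix M^p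
satisfies the quadratic equation of N. Powers of M^p and of N therefore have the same coordinates,
which yields B_{k+1} D = D B_k', where B_k' is the Frobenius image of B_k (`blockMat_frobenius`).
Let Θ_k be the tail of Θ starting at block k. The series (Θ_k^p + f_{p-2})/f_{p-1} then obey the
recursion of the Θ_{k+1}, and equal them because continued fraction maps contract
(`frobStep_thetaTail`). The case k = 0, together with Θ = [X, -X/3, Θ_1], is the stated equation.

For the Littlewood property, the quotient of two consecutive denominators of Θ is its continued
fraction read backwards. At the end of L_k(3) it begins with p^k - 1 partial quotients of Φ, while
everything before is short. Hence q_n - Φ q_{n-1} tends to 0 along these n, whereas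
|q_{n-1}|·‖q_{n-1}Θ‖ ≤ 1 (`exists_littlewood_le`).

For the degree of Θ, give X weight p and Z weight p - 2. The leading form of the polynomial is 2X^p
- X²Z^p. A nonzero A of least degree vanishing at Θ divides the polynomial up to a factor in F_p[X];
if deg A ≤ p, its leading form has degree 0 or p in Z. Degree 0 forces deg A ≤ 1, but Θ is
irrational; degree p makes the Z^p term of A dominate at Θ, so A(Θ) ≠ 0. As p + 1 > 2, a relation
between 1, Θ and the quadratic Φ is impossible. -/

lemma absVal_zero : absVal (0 : LaurentSeries K) = 0 := by simp [absVal]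

lemma absVal_of_ne_zero {F : LaurentSeries K} (hF : F ≠ 0) :
    absVal F = (2 : ℝ) ^ (-F.order) := by simp [absVal, hF]

lemma absVal_nonneg (F : LaurentSeries K) : 0 ≤ absVal F := by
  unfold absVal; split_ifs <;> positivity

lemma absVal_eq_zero {F : LaurentSeries K} : absVal F = 0 ↔ F = 0 := by
  constructor
  · intro h
    by_contra hF
    rw [absVal_of_ne_zero hF] at h
    have : (0 : ℝ) < (2 : ℝ) ^ (-F.order) := by positivity
    linarith
  · rintro rfl; exact absVal_zero

lemma absVal_mul (F G : LaurentSeries K) : absVal (F * G) = absVal F * absVal G := by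
  by_cases hF : F = 0
  · simp [hF, absVal_zero]
  by_cases hG : G = 0
  · simp [hG, absVal_zero]
  rw [absVal_of_ne_zero (mul_ne_zero hF hG), absVal_of_ne_zero hF, absVal_of_ne_zero hG,
    HahnSeries.order_mul hF hG, ← zpow_add₀ (by norm_num)]
  congr 1; ring

lemma absVal_add_le_max (F G : LaurentSeries K) :
    absVal (F + G) ≤ max (absVal F) (absVal G) := by
  by_cases hF : F = 0
  · simp [hF]
  by_cases hG : G = 0
  · simp [hG]
  by_cases hFG : F + G = 0
  · rw [hFG, absVal_zero]; exact le_max_of_le_left (absVal_nonneg F)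
  rw [absVal_of_ne_zero hFG, absVal_of_ne_zero hF, absVal_of_ne_zero hG]
  have h := HahnSeries.min_order_le_order_add hFG
  rcases min_le_iff.mp h with h | h
  · exact le_max_of_le_left (zpow_le_zpow_right₀ (by norm_num) (by omega))
  · exact le_max_of_le_right (zpow_le_zpow_right₀ (by norm_num) (by omega))

/-- The norm of `K((X⁻¹))` as an absolute value. -/
noncomputable def laurentAbs (K : Type*) [Field K] : AbsoluteValue (LaurentSeries K) ℝ where
  toFun := absVal
  map_mul' := absVal_mul
  nonneg' := absVal_nonneg
  eq_zero' _ := absVal_eq_zero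
  add_le' F G := (absVal_add_le_max F G).trans
    (max_le (by linarith [absVal_nonneg G]) (by linarith [absVal_nonneg F]))

lemma laurentAbs_isNonarchimedean : IsNonarchimedean (laurentAbs K) := absVal_add_le_max

lemma absVal_one : absVal (1 : LaurentSeries K) = 1 := (laurentAbs K).map_one

lemma absVal_neg (F : LaurentSeries K) : absVal (-F) = absVal F := (laurentAbs K).map_neg F

lemma absVal_sub_comm (F G : LaurentSeries K) : absVal (F - G) = absVal (G - F) := by
  rw [← absVal_neg, neg_sub]

lemma absVal_inv (F : LaurentSeries K) : absVal F⁻¹ = (absVal F)⁻¹ := map_inv₀ (laurentAbs K) F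

lemma absVal_div (F G : LaurentSeries K) : absVal (F / G) = absVal F / absVal G :=
  map_div₀ (laurentAbs K) F G

lemma absVal_pow (F : LaurentSeries K) (n : ℕ) : absVal (F ^ n) = absVal F ^ n :=
  map_pow (laurentAbs K) F n

lemma absVal_pos {F : LaurentSeries K} (hF : F ≠ 0) : 0 < absVal F := (laurentAbs K).pos hF

lemma absVal_add_eq_left {F G : LaurentSeries K} (h : absVal G < absVal F) :
    absVal (F + G) = absVal F :=
  laurentAbs_isNonarchimedean.add_eq_left_of_lt (f := laurentAbs K) h

lemma absVal_sub_le_max (F G : LaurentSeries K) :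
    absVal (F - G) ≤ max (absVal F) (absVal G) := by
  rw [sub_eq_add_neg, ← absVal_neg G]; exact absVal_add_le_max _ _

lemma absVal_le_two_zpow_iff {F : LaurentSeries K} {m : ℤ} :
    absVal F ≤ 2 ^ (-m) ↔ ∀ i < m, F.coeff i = 0 := by
  by_cases hF : F = 0
  · subst hF; simp only [absVal_zero, HahnSeries.coeff_zero, implies_true, iff_true]; positivity
  rw [absVal_of_ne_zero hF, zpow_le_zpow_iff_right₀ (by norm_num), neg_le_neg_iff,
    HahnSeries.le_order_iff_forall hF]

lemma absVal_lt_one_iff {F : LaurentSeries K} :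
    absVal F < 1 ↔ ∀ i ≤ 0, F.coeff i = 0 := by
  by_cases hF : F = 0
  · subst hF; simp [absVal_zero]
  have h : absVal F < 1 ↔ absVal F ≤ 2 ^ (-1 : ℤ) := by
    rw [absVal_of_ne_zero hF, zpow_le_zpow_iff_right₀ (by norm_num)]
    have := zpow_lt_zpow_iff_right₀ (a := (2 : ℝ)) (by norm_num) (m := -F.order) (n := 0)
    rw [zpow_zero] at this
    rw [this]; omega
  rw [h, absVal_le_two_zpow_iff]
  exact ⟨fun h i hi => h i (by omega), fun h i hi => h i (by omega)⟩

lemma polyEmb_monomial (n : ℕ) (r : K) :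
    polyEmb (monomial n r) = HahnSeries.single (-(n : ℤ)) r := by
  simp [polyEmb, HahnSeries.C_apply, HahnSeries.single_pow]

lemma polyEmb_coeff_neg (a : K[X]) (i : ℕ) : (polyEmb a).coeff (-(i : ℤ)) = a.coeff i := by
  induction a using Polynomial.induction_on' with
  | add a b ha hb => simp [ha, hb]
  | monomial n r =>
    rw [polyEmb_monomial, HahnSeries.coeff_single, coeff_monomial]
    by_cases h : n = i
    · simp [h]
    · rw [if_neg (by omega), if_neg h]

lemma polyEmb_injective : Function.Injective (polyEmb : K[X] →+* LaurentSeries K) := by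
  rw [injective_iff_map_eq_zero]
  intro a ha
  ext i
  rw [← polyEmb_coeff_neg, ha]; simp

lemma polyEmb_eq_zero {a : K[X]} : polyEmb a = 0 ↔ a = 0 :=
  map_eq_zero_iff _ polyEmb_injective

lemma polyEmb_ne_zero {a : K[X]} (ha : a ≠ 0) : polyEmb a ≠ 0 := polyEmb_eq_zero.not.mpr ha

lemma order_polyEmb {a : K[X]} (ha : a ≠ 0) : (polyEmb a).order = -(a.natDegree : ℤ) := by
  apply le_antisymm
  · apply HahnSeries.order_le_of_coeff_ne_zero
    rw [polyEmb_coeff_neg]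
    simpa using ha
  · rw [HahnSeries.le_order_iff_forall (polyEmb_ne_zero ha)]
    intro i hi
    obtain ⟨n, rfl⟩ : ∃ n : ℕ, i = -(n : ℤ) := ⟨(-i).toNat, by omega⟩
    rw [polyEmb_coeff_neg]
    exact coeff_eq_zero_of_natDegree_lt (by omega)

lemma absVal_polyEmb {a : K[X]} (ha : a ≠ 0) : absVal (polyEmb a) = 2 ^ a.natDegree := by
  rw [absVal_of_ne_zero (polyEmb_ne_zero ha), order_polyEmb ha, neg_neg, zpow_natCast]

lemma one_le_absVal_polyEmb {a : K[X]} (ha : a ≠ 0) : 1 ≤ absVal (polyEmb a) := by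
  rw [absVal_polyEmb ha]; exact one_le_pow₀ (by norm_num)

lemma absVal_polyEmb_lt_iff {a b : K[X]} (ha : a ≠ 0) (hb : b ≠ 0) :
    absVal (polyEmb a) < absVal (polyEmb b) ↔ a.natDegree < b.natDegree := by
  rw [absVal_polyEmb ha, absVal_polyEmb hb, pow_lt_pow_iff_right₀ (by norm_num)]

lemma polyEmb_polyPart_coeff (F : LaurentSeries K) {i : ℤ} (hi : i ≤ 0) :
    (polyEmb (polyPart F)).coeff i = F.coeff i := by
  obtain ⟨n, rfl⟩ : ∃ n : ℕ, i = -(n : ℤ) := ⟨(-i).toNat, by omega⟩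
  rw [polyEmb_coeff_neg, polyPart, finsetSum_coeff]
  simp only [coeff_monomial, Finset.sum_ite_eq', Finset.mem_range]
  split_ifs with h
  · rfl
  · rw [HahnSeries.coeff_eq_zero_of_lt_order]
    omega

lemma absVal_fracPart_lt_one (F : LaurentSeries K) : absVal (fracPart F) < 1 := by
  rw [absVal_lt_one_iff]
  intro i hi
  rw [fracPart, HahnSeries.coeff_sub, polyEmb_polyPart_coeff F hi, sub_self]

lemma polyEmb_polyPart_add_fracPart (F : LaurentSeries K) :
    polyEmb (polyPart F) + fracPart F = F := by rw [fracPart]; ring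

lemma eq_zero_of_absVal_polyEmb_lt_one {a : K[X]} (h : absVal (polyEmb a) < 1) : a = 0 := by
  by_contra ha
  exact absurd (one_le_absVal_polyEmb ha) (not_le.mpr h)

lemma polyPart_eq {F : LaurentSeries K} {a : K[X]} (h : absVal (F - polyEmb a) < 1) :
    polyPart F = a := by
  rw [← sub_eq_zero]
  apply eq_zero_of_absVal_polyEmb_lt_one
  have : polyEmb (polyPart F - a) = (F - polyEmb a) - fracPart F := by
    rw [fracPart, map_sub]; ring
  rw [this]
  exact (absVal_sub_le_max _ _).trans_lt (max_lt h (absVal_fracPart_lt_one F))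

lemma fracPart_eq {F : LaurentSeries K} {a : K[X]} (h : absVal (F - polyEmb a) < 1) :
    fracPart F = F - polyEmb a := by rw [fracPart, polyPart_eq h]

lemma fracNorm_le (F : LaurentSeries K) (r : K[X]) : fracNorm F ≤ absVal (F - polyEmb r) := by
  by_cases h : absVal (F - polyEmb r) < 1
  · rw [fracNorm, fracPart_eq h]
  · exact (absVal_fracPart_lt_one F).le.trans (not_lt.mp h)

lemma fracNorm_nonneg (F : LaurentSeries K) : 0 ≤ fracNorm F := absVal_nonneg _

/-- Completeness of `K((X⁻¹))`, in the form needed for convergents. -/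
lemma exists_limit {F : ℕ → LaurentSeries K}
    (hF : ∀ n, absVal (F (n + 1) - F n) ≤ (2 : ℝ) ^ (-(n : ℤ))) :
    ∃ L, ∀ n, absVal (L - F n) ≤ (2 : ℝ) ^ (-(n : ℤ)) := by
  have hmn : ∀ m n, n ≤ m → absVal (F m - F n) ≤ (2 : ℝ) ^ (-(n : ℤ)) := by
    intro m n h
    induction m, h using Nat.le_induction with
    | base => rw [sub_self, absVal_zero]; positivity
    | succ m hm ih =>
      rw [show F (m + 1) - F n = (F (m + 1) - F m) + (F m - F n) by ring]
      refine (absVal_add_le_max _ _).trans (max_le ((hF m).trans ?_) ih)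
      exact zpow_le_zpow_right₀ (by norm_num) (by omega)
  -- All `F n` differ from `F 0` by power series in T, so only coefficients of `T ^ m` with m ≥ 0
  -- move; the one at m is final from index m + 1 on.
  refine ⟨F 0 + HahnSeries.ofPowerSeries ℤ K
    (PowerSeries.mk fun m => (F (m + 1) - F 0).coeff (m : ℤ)), fun n => ?_⟩
  rw [absVal_le_two_zpow_iff]
  intro i hi
  have h0 := absVal_le_two_zpow_iff.mp (hmn n 0 (Nat.zero_le n))
  rcases lt_or_ge i 0 with hi0 | hi0
  · have h := h0 i (by simpa using hi0)
    rw [HahnSeries.coeff_sub] at h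
    rw [HahnSeries.coeff_sub, HahnSeries.coeff_add, HahnSeries.ofPowerSeries_apply,
      HahnSeries.embDomain_of_notMem_range]
    · linear_combination -h
    · rintro ⟨j, hj⟩
      simp at hj
      omega
  · obtain ⟨m, rfl⟩ : ∃ m : ℕ, i = m := ⟨i.toNat, by omega⟩
    have h := absVal_le_two_zpow_iff.mp (hmn n (m + 1) (by omega)) m (by push_cast; omega)
    rw [HahnSeries.coeff_sub] at h
    rw [HahnSeries.coeff_sub, HahnSeries.coeff_add, HahnSeries.ofPowerSeries_apply_coeff,
      PowerSeries.coeff_mk, HahnSeries.coeff_sub]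
    linear_combination -h

end Valuation

/-! ### Continued fractions: contraction, uniqueness, existence. -/

section ContinuedFraction

variable {K : Type*} [Field K]

lemma two_le_absVal_polyEmb {a : K[X]} (ha : 1 ≤ a.natDegree) : 2 ≤ absVal (polyEmb a) := by
  rw [absVal_polyEmb (ne_zero_of_natDegree_gt ha)]
  exact le_self_pow₀ (by norm_num) (by omega)

lemma ne_zero_of_two_le_absVal {F : LaurentSeries K} (h : 2 ≤ absVal F) : F ≠ 0 := by
  rintro rfl; rw [absVal_zero] at h; norm_num at h

lemma absVal_inv_lt_one {F : LaurentSeries K} (h : 2 ≤ absVal F) : absVal F⁻¹ < 1 := by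
  rw [absVal_inv]; exact inv_lt_one_of_one_lt₀ (by linarith)

lemma absVal_inv_sub_inv_le {F G : LaurentSeries K} (hF : 2 ≤ absVal F) (hG : 2 ≤ absVal G) :
    absVal (F⁻¹ - G⁻¹) ≤ absVal (F - G) / 4 := by
  rw [inv_sub_inv (ne_zero_of_two_le_absVal hF) (ne_zero_of_two_le_absVal hG), absVal_div,
    absVal_mul, absVal_sub_comm G F]
  exact div_le_div_of_nonneg_left (absVal_nonneg _) (by norm_num) (by nlinarith)

lemma absVal_polyEmb_add_inv {a : K[X]} (ha : 1 ≤ a.natDegree) {F : LaurentSeries K}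
    (hF : 2 ≤ absVal F) : absVal (polyEmb a + F⁻¹) = absVal (polyEmb a) :=
  absVal_add_eq_left ((absVal_inv_lt_one hF).trans_le (by linarith [two_le_absVal_polyEmb ha]))

/-- The value `[a₀, …, aₙ₋₁, F]`. -/
noncomputable def cfEval (l : List K[X]) (F : LaurentSeries K) : LaurentSeries K :=
  l.foldr (fun a G => polyEmb a + G⁻¹) F

@[simp] lemma cfEval_nil (F : LaurentSeries K) : cfEval [] F = F := rfl

@[simp] lemma cfEval_cons (a : K[X]) (l : List K[X]) (F : LaurentSeries K) :
    cfEval (a :: l) F = polyEmb a + (cfEval l F)⁻¹ := rfl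

lemma two_le_absVal_cfEval {l : List K[X]} (hl : ∀ a ∈ l, 1 ≤ a.natDegree) {F : LaurentSeries K}
    (hF : 2 ≤ absVal F) : 2 ≤ absVal (cfEval l F) := by
  induction l with
  | nil => exact hF
  | cons a l ih =>
    rw [List.forall_mem_cons] at hl
    rw [cfEval_cons, absVal_polyEmb_add_inv hl.1 (ih hl.2)]
    exact two_le_absVal_polyEmb hl.1

/-- On norms at least 2, each map F ↦ a + 1/F divides distances by at least 4 and keeps the norm at
least 2. -/
lemma absVal_cfEval_sub_le {l : List K[X]} (hl : ∀ a ∈ l, 1 ≤ a.natDegree)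
    {F G : LaurentSeries K} (hF : 2 ≤ absVal F) (hG : 2 ≤ absVal G) :
    absVal (cfEval l F - cfEval l G) ≤ absVal (F - G) / 4 ^ l.length := by
  induction l with
  | nil => simp
  | cons a l ih =>
    rw [List.forall_mem_cons] at hl
    rw [cfEval_cons, cfEval_cons, add_sub_add_left_eq_sub, List.length_cons, pow_succ, ← div_div]
    refine (absVal_inv_sub_inv_le (two_le_absVal_cfEval hl.2 hF)
      (two_le_absVal_cfEval hl.2 hG)).trans ?_
    have := ih hl.2
    gcongr

/-- The sequence `a`, without its first `m` terms. -/
def seqDrop {α : Type*} (m : ℕ) (a : ℕ → α) : ℕ → α := fun n => a (m + n)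

lemma completeQuotient_add (F : LaurentSeries K) (m n : ℕ) :
    completeQuotient F (m + n) = completeQuotient (completeQuotient F m) n := by
  induction n with
  | zero => rfl
  | succ n ih => rw [← add_assoc, completeQuotient, ih, completeQuotient]

lemma HasContFrac.drop {F : LaurentSeries K} {a : ℕ → K[X]} (h : HasContFrac F a) (m : ℕ) :
    HasContFrac (completeQuotient F m) (seqDrop m a) := by
  intro n
  rw [← completeQuotient_add]
  exact h (m + n)

lemma HasContFrac.eq_head_add {F : LaurentSeries K} {a : ℕ → K[X]} (h : HasContFrac F a) :
    F = polyEmb (a 0) + (completeQuotient F 1)⁻¹ := by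
  have h0 := (h 0).2
  simp only [completeQuotient] at h0
  simp only [completeQuotient, inv_inv]
  rw [← h0, polyEmb_polyPart_add_fracPart]

lemma HasContFrac.two_le_absVal {F : LaurentSeries K} {a : ℕ → K[X]} (h : HasContFrac F a)
    (ha : 1 ≤ (a 0).natDegree) : 2 ≤ absVal F := by
  have h0 := (h 0).2
  simp only [completeQuotient] at h0
  rw [← polyEmb_polyPart_add_fracPart F, h0, absVal_add_eq_left]
  · exact two_le_absVal_polyEmb ha
  · exact (absVal_fracPart_lt_one F).trans_le (by linarith [two_le_absVal_polyEmb ha])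

lemma HasContFrac.absVal_eq {F : LaurentSeries K} {a : ℕ → K[X]} (h : HasContFrac F a)
    (ha : ∀ n, 1 ≤ (a n).natDegree) : absVal F = absVal (polyEmb (a 0)) := by
  rw [h.eq_head_add]
  exact absVal_polyEmb_add_inv (ha 0) ((h.drop 1).two_le_absVal (ha _))

lemma HasContFrac.eq_cfEval {F : LaurentSeries K} {a : ℕ → K[X]} (h : HasContFrac F a) (m : ℕ) :
    F = cfEval ((List.range m).map a) (completeQuotient F m) := by
  induction m generalizing F a with
  | zero => rfl
  | succ m ih =>
    rw [List.range_succ_eq_map, List.map_cons, cfEval_cons, List.map_map, add_comm m 1,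
      completeQuotient_add]
    have := ih (h.drop 1)
    rw [show (a ∘ Nat.succ) = seqDrop 1 a by funext n; simp [seqDrop, add_comm], ← this]
    exact h.eq_head_add

lemma eq_of_forall_absVal_sub_le {F G : LaurentSeries K} {C : ℝ}
    (h : ∀ n : ℕ, absVal (F - G) ≤ C / 4 ^ n) : F = G := by
  by_contra hne
  have hpos := absVal_pos (sub_ne_zero.mpr hne)
  have hlim : Filter.Tendsto (fun n : ℕ => C / 4 ^ n) Filter.atTop (nhds 0) :=
    tendsto_const_nhds.div_atTop (tendsto_pow_atTop_atTop_of_one_lt (by norm_num))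
  exact absurd (ge_of_tendsto' hlim h) (not_le.mpr hpos)

lemma HasContFrac.unique {F G : LaurentSeries K} {a : ℕ → K[X]} (hF : HasContFrac F a)
    (hG : HasContFrac G a) (ha : ∀ n, 1 ≤ (a n).natDegree) : F = G := by
  refine eq_of_forall_absVal_sub_le (C := 1) fun n => ?_
  induction n generalizing F G a with
  | zero =>
    have h0F := (hF 0).2
    have h0G := (hG 0).2
    simp only [completeQuotient] at h0F h0G
    rw [← polyEmb_polyPart_add_fracPart F, ← polyEmb_polyPart_add_fracPart G, h0F, h0G,
      add_sub_add_left_eq_sub]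
    simpa using (absVal_sub_le_max _ _).trans
      (max_le (absVal_fracPart_lt_one F).le (absVal_fracPart_lt_one G).le)
  | succ n ih =>
    have ha1 : ∀ n, 1 ≤ (seqDrop 1 a n).natDegree := fun _ => ha _
    have h := ih (hF.drop 1) (hG.drop 1) ha1
    rw [hF.eq_head_add, hG.eq_head_add, add_sub_add_left_eq_sub, pow_succ, ← div_div]
    refine (absVal_inv_sub_inv_le ((hF.drop 1).two_le_absVal (ha1 0))
      ((hG.drop 1).two_le_absVal (ha1 0))).trans ?_
    gcongr

/-- The inverse of `V (n + 1)` has norm below 1, so `a n` is forced to be the polynomial part of `V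
n`, and the algorithm reproduces the `V n` as its complete quotients. -/
lemma HasContFrac.of_recursion {V : ℕ → LaurentSeries K} {a : ℕ → K[X]}
    (hV : ∀ n, 2 ≤ absVal (V n)) (h : ∀ n, V n = polyEmb (a n) + (V (n + 1))⁻¹) :
    HasContFrac (V 0) a := by
  have key : ∀ n, absVal (V n - polyEmb (a n)) < 1 := by
    intro n
    rw [h n, add_sub_cancel_left]
    exact absVal_inv_lt_one (hV _)
  have hf : ∀ n, fracPart (V n) = (V (n + 1))⁻¹ := by
    intro n
    rw [fracPart_eq (key n)]
    conv_lhs => rw [h n]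
    ring
  have hq : ∀ n, completeQuotient (V 0) n = V n := by
    intro n
    induction n with
    | zero => rfl
    | succ n ih => rw [completeQuotient, ih, hf, inv_inv]
  intro n
  rw [hq, hf]
  exact ⟨inv_ne_zero (ne_zero_of_two_le_absVal (hV _)), polyPart_eq (key n)⟩

/-- The convergents `[a₀, …, aₙ]`. -/
noncomputable def cfConv (a : ℕ → K[X]) : ℕ → LaurentSeries K
  | 0 => polyEmb (a 0)
  | n + 1 => polyEmb (a 0) + (cfConv (seqDrop 1 a) n)⁻¹

lemma two_le_absVal_cfConv {a : ℕ → K[X]} (ha : ∀ n, 1 ≤ (a n).natDegree) (n : ℕ) :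
    2 ≤ absVal (cfConv a n) := by
  induction n generalizing a with
  | zero => exact two_le_absVal_polyEmb (ha 0)
  | succ n ih =>
    rw [cfConv, absVal_polyEmb_add_inv (ha 0) (ih (a := seqDrop 1 a) fun _ => ha _)]
    exact two_le_absVal_polyEmb (ha 0)

lemma absVal_cfConv_sub_le {a : ℕ → K[X]} (ha : ∀ n, 1 ≤ (a n).natDegree) (n : ℕ) :
    absVal (cfConv a (n + 1) - cfConv a n) ≤ (2 : ℝ) ^ (-(n : ℤ)) := by
  induction n generalizing a with
  | zero =>
    simp only [cfConv, add_sub_cancel_left]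
    simpa using (absVal_inv_lt_one (two_le_absVal_polyEmb (a := seqDrop 1 a 0) (ha _))).le
  | succ n ih =>
    have ha1 : ∀ n, 1 ≤ (seqDrop 1 a n).natDegree := fun _ => ha _
    rw [cfConv, show cfConv a (n + 1) = polyEmb (a 0) + (cfConv (seqDrop 1 a) n)⁻¹ from rfl,
      add_sub_add_left_eq_sub]
    have h := ih ha1
    refine (absVal_inv_sub_inv_le (two_le_absVal_cfConv ha1 _)
      (two_le_absVal_cfConv ha1 _)).trans ?_
    rw [Nat.cast_succ, neg_add, zpow_add₀ (by norm_num)]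
    have : (0 : ℝ) < 2 ^ (-(n : ℤ)) := by positivity
    have e : (2 : ℝ) ^ (-(1 : ℤ)) = 1 / 2 := by norm_num
    rw [e]
    linarith

/-- The convergents of every tail of `a` converge, and their limits inherit the recursion because
inversion is Lipschitz on norms at least 2. -/
theorem exists_hasContFrac {a : ℕ → K[X]} (ha : ∀ n, 1 ≤ (a n).natDegree) :
    ∃ F, HasContFrac F a := by
  have hex : ∀ m, ∃ L, ∀ n, absVal (L - cfConv (seqDrop m a) n) ≤ (2 : ℝ) ^ (-(n : ℤ)) :=
    fun m => exists_limit fun n => absVal_cfConv_sub_le (fun _ => ha _) n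
  choose V hV using hex
  have hV2 : ∀ m, 2 ≤ absVal (V m) := by
    intro m
    have h0 := hV m 0
    have h2 := two_le_absVal_cfConv (a := seqDrop m a) (fun _ => ha _) 0
    rw [show V m = cfConv (seqDrop m a) 0 + (V m - cfConv (seqDrop m a) 0) by ring,
      absVal_add_eq_left]
    · exact h2
    · norm_num at h0; linarith
  refine ⟨V 0, HasContFrac.of_recursion hV2 fun m => ?_⟩
  refine eq_of_forall_absVal_sub_le (C := 1) fun n => ?_
  -- Index 2n turns the convergence rate 2^(-n) into the 4^(-n) of `eq_of_forall_absVal_sub_le`.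
  have hc : cfConv (seqDrop m a) (2 * n + 1) =
      polyEmb (a m) + (cfConv (seqDrop (m + 1) a) (2 * n))⁻¹ := by
    rw [cfConv]; congr 3
    funext i; simp [seqDrop, add_assoc]
  have h1 := hV m (2 * n + 1)
  have h2 := (absVal_inv_sub_inv_le (two_le_absVal_cfConv (a := seqDrop (m + 1) a)
    (fun _ => ha _) (2 * n)) (hV2 (m + 1))).trans (div_le_self (absVal_nonneg _) (by norm_num))
  rw [absVal_sub_comm (cfConv _ _) (V (m + 1))] at h2
  have h2' := h2.trans (hV (m + 1) (2 * n))
  have e : V m - (polyEmb (a m) + (V (m + 1))⁻¹) = (V m - cfConv (seqDrop m a) (2 * n + 1)) +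
      ((cfConv (seqDrop (m + 1) a) (2 * n))⁻¹ - (V (m + 1))⁻¹) := by rw [hc]; ring
  rw [e]
  have e4 : (1 : ℝ) / 4 ^ n = 2 ^ (-((2 * n : ℕ) : ℤ)) := by
    rw [zpow_neg, zpow_natCast, pow_mul]; norm_num
  rw [e4]
  refine (absVal_add_le_max _ _).trans (max_le (h1.trans ?_) ?_)
  · exact zpow_le_zpow_right₀ (by norm_num) (by omega)
  · exact h2'

end ContinuedFraction

/-! ### Continuant matrices and the quality of rational approximations. -/

section Approximation

variable {K : Type*} [Field K]

/-- The matrix `Q` maps `F` to `G` as a fractional linear transformation. -/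
def MobiusRel (Q : Matrix (Fin 2) (Fin 2) K[X]) (F G : LaurentSeries K) : Prop :=
  ∃ c ≠ 0, polyEmb (Q 0 0) * F + polyEmb (Q 0 1) = c * G ∧
    polyEmb (Q 1 0) * F + polyEmb (Q 1 1) = c

lemma MobiusRel.comp {P Q : Matrix (Fin 2) (Fin 2) K[X]} {F G H : LaurentSeries K}
    (hP : MobiusRel P G H) (hQ : MobiusRel Q F G) : MobiusRel (P * Q) F H := by
  obtain ⟨c, hc, h1, h2⟩ := hP
  obtain ⟨d, hd, h3, h4⟩ := hQ
  refine ⟨c * d, mul_ne_zero hc hd, ?_, ?_⟩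
  · simp only [Matrix.mul_apply, Fin.sum_univ_two, map_add, map_mul]
    linear_combination polyEmb (P 0 0) * h3 + polyEmb (P 0 1) * h4 + d * h1
  · simp only [Matrix.mul_apply, Fin.sum_univ_two, map_add, map_mul]
    linear_combination polyEmb (P 1 0) * h3 + polyEmb (P 1 1) * h4 + d * h2

lemma MobiusRel.of_comp {P Q : Matrix (Fin 2) (Fin 2) K[X]} {F G H : LaurentSeries K}
    (hPQ : MobiusRel (P * Q) F H) (hQ : MobiusRel Q F G) : MobiusRel P G H := by
  obtain ⟨c, hc, h1, h2⟩ := hPQ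
  obtain ⟨d, hd, h3, h4⟩ := hQ
  simp only [Matrix.mul_apply, Fin.sum_univ_two, map_add, map_mul] at h1 h2
  refine ⟨c / d, div_ne_zero hc hd, ?_, ?_⟩
  · field_simp
    linear_combination h1 - polyEmb (P 0 0) * h3 - polyEmb (P 0 1) * h4
  · field_simp
    linear_combination h2 - polyEmb (P 1 0) * h3 - polyEmb (P 1 1) * h4

lemma MobiusRel.right_unique {Q : Matrix (Fin 2) (Fin 2) K[X]} {F G H : LaurentSeries K}
    (hG : MobiusRel Q F G) (hH : MobiusRel Q F H) : G = H := by
  obtain ⟨c, hc, h1, h2⟩ := hG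
  obtain ⟨d, hd, h3, h4⟩ := hH
  obtain rfl : c = d := h2.symm.trans h4
  exact mul_left_cancel₀ hc (h1.symm.trans h3)

/-- The matrix of the map `F ↦ a + 1 / F`. -/
noncomputable def cfMat (a : K[X]) : Matrix (Fin 2) (Fin 2) K[X] := !![a, 1; 1, 0]

/-- The matrix of the map `F ↦ [a₀, …, aₙ₋₁, F]`. -/
noncomputable def cfMatProd (l : List K[X]) : Matrix (Fin 2) (Fin 2) K[X] := (l.map cfMat).prod

lemma cfMatProd_cons (a : K[X]) (l : List K[X]) :
    cfMatProd (a :: l) = cfMat a * cfMatProd l := by simp [cfMatProd]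

lemma cfMatProd_append (l l' : List K[X]) :
    cfMatProd (l ++ l') = cfMatProd l * cfMatProd l' := by simp [cfMatProd]

lemma cfMatProd_flatten_replicate (l : List K[X]) (n : ℕ) :
    cfMatProd (List.replicate n l).flatten = cfMatProd l ^ n := by
  induction n with
  | zero => simp [cfMatProd]
  | succ n ih => rw [List.replicate_succ, List.flatten_cons, cfMatProd_append, ih, pow_succ']

lemma det_cfMatProd (l : List K[X]) : (cfMatProd l).det = (-1) ^ l.length := by
  induction l with
  | nil => simp [cfMatProd]
  | cons a l ih =>
    rw [cfMatProd_cons, Matrix.det_mul, ih, cfMat, Matrix.det_fin_two_of, List.length_cons]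
    ring

lemma mobiusRel_cfMatProd {l : List K[X]} (hl : ∀ a ∈ l, 1 ≤ a.natDegree) {F : LaurentSeries K}
    (hF : 2 ≤ absVal F) : MobiusRel (cfMatProd l) F (cfEval l F) := by
  induction l with
  | nil => exact ⟨1, one_ne_zero, by simp [cfMatProd], by simp [cfMatProd]⟩
  | cons a l ih =>
    rw [List.forall_mem_cons] at hl
    rw [cfMatProd_cons]
    refine MobiusRel.comp ?_ (ih hl.2)
    have h0 := ne_zero_of_two_le_absVal (two_le_absVal_cfEval hl.2 hF)
    refine ⟨cfEval l F, h0, ?_, ?_⟩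
    · simp only [cfMat, Matrix.of_apply, Matrix.cons_val', Matrix.cons_val_zero,
        Matrix.cons_val_one, cfEval_cons, map_one, Matrix.cons_val_fin_one]
      field_simp
    · simp [cfMat]

lemma cfMatProd_concat_one_zero (l : List K[X]) (a : K[X]) :
    cfMatProd (l ++ [a]) 1 0 = cfMatProd l 1 0 * a + cfMatProd l 1 1 := by
  rw [cfMatProd_append]
  simp [cfMatProd, cfMat, Matrix.mul_apply, Fin.sum_univ_two]

lemma cfMatProd_concat_one_one (l : List K[X]) (a : K[X]) :
    cfMatProd (l ++ [a]) 1 1 = cfMatProd l 1 0 := by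
  rw [cfMatProd_append]
  simp [cfMatProd, cfMat, Matrix.mul_apply, Fin.sum_univ_two]

/-- The bottom row holds the last two denominators, which satisfy q_n = a_n q_{n-1} + q_{n-2}. The
first letter does not enter the denominators, hence `l.length` and not one more. The last letter is
split off because the bottom row of the empty word is (0, 1). -/
lemma degree_cfMatProd_concat {l : List K[X]} (hl : ∀ a ∈ l, a.degree = 1) {b : K[X]}
    (hb : b.degree = 1) :
    (cfMatProd (l ++ [b]) 1 0).degree = l.length ∧
      (cfMatProd (l ++ [b]) 1 1).degree < l.length := by
  induction l using List.reverseRecOn generalizing b with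
  | nil => simp [cfMatProd, cfMat]
  | append_singleton l a ih =>
    have h := ih (fun x hx => hl x (by simp [hx])) (hl a (by simp))
    rw [cfMatProd_concat_one_zero, cfMatProd_concat_one_one (l ++ [a])]
    have hlt : ((l.length : ℕ) : WithBot ℕ) < (l.length + 1 : ℕ) := by
      exact_mod_cast Nat.lt_succ_self _
    have hd : (cfMatProd (l ++ [a]) 1 0 * b).degree = (l.length + 1 : ℕ) := by
      rw [degree_mul, h.1, hb]; rfl
    rw [List.length_append, List.length_singleton, h.1]
    refine ⟨?_, hlt⟩
    rw [degree_add_eq_left_of_degree_lt, hd]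
    rw [hd]
    exact h.2.trans hlt

/-- The denominators of a convergent of `F` approximate `F` well. -/
lemma absVal_mul_fracNorm_le_one {l : List K[X]} (hl : ∀ a ∈ l, a.degree = 1) {b : K[X]}
    (hb : b.degree = 1) {F : LaurentSeries K} (hF : 2 ≤ absVal F) :
    absVal (polyEmb (cfMatProd (l ++ [b]) 1 1)) *
      fracNorm (polyEmb (cfMatProd (l ++ [b]) 1 1) * cfEval (l ++ [b]) F) ≤ 1 := by
  have hl' : ∀ a ∈ l ++ [b], 1 ≤ a.natDegree := by
    intro a ha
    rw [List.mem_append, List.mem_singleton] at ha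
    rcases ha with ha | rfl
    · exact (natDegree_eq_of_degree_eq_some (hl a ha)).ge
    · exact (natDegree_eq_of_degree_eq_some hb).ge
  obtain ⟨c, hc, h1, h2⟩ := mobiusRel_cfMatProd hl' hF
  have hdet := congrArg polyEmb (det_cfMatProd (l ++ [b]))
  obtain ⟨hd0, hd1⟩ := degree_cfMatProd_concat hl hb
  rw [Matrix.det_fin_two] at hdet
  set Q := cfMatProd (l ++ [b])
  set G := cfEval (l ++ [b]) F
  simp only [map_sub, map_mul, map_pow, map_neg, map_one] at hdet
  have hlt : absVal (polyEmb (Q 1 1)) ≤ absVal (polyEmb (Q 1 0)) := by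
    by_cases h0 : Q 1 1 = 0
    · rw [h0, map_zero, absVal_zero]; exact absVal_nonneg _
    · refine ((absVal_polyEmb_lt_iff h0 ?_).mpr (natDegree_lt_natDegree h0 ?_)).le
      · rintro h; simp [h] at hd0
      · rwa [hd0]
  have h0 : 0 < absVal (polyEmb (Q 1 0)) := by
    apply absVal_pos; apply polyEmb_ne_zero; rintro h; simp [h] at hd0
  have hcabs : absVal c = absVal (polyEmb (Q 1 0)) * absVal F := by
    rw [← h2, absVal_add_eq_left, absVal_mul]
    rw [absVal_mul]
    nlinarith
  have hFpos : 0 < absVal F := by linarith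
  -- Solving the two Möbius equations for F with determinant ±1 gives c (Q₁₁ G - Q₀₁) = ±F.
  have hkey : absVal c * absVal (polyEmb (Q 1 1) * G - polyEmb (Q 0 1)) = absVal F := by
    rw [← absVal_mul, show c * (polyEmb (Q 1 1) * G - polyEmb (Q 0 1)) =
      (-1) ^ (l ++ [b]).length * F by
        linear_combination -polyEmb (Q 1 1) * h1 + polyEmb (Q 0 1) * h2 + F * hdet,
      absVal_mul, absVal_pow, absVal_neg, absVal_one, one_pow, one_mul]
  have hval : absVal (polyEmb (Q 1 0)) * absVal (polyEmb (Q 1 1) * G - polyEmb (Q 0 1)) = 1 := by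
    rw [hcabs] at hkey
    apply mul_left_cancel₀ hFpos.ne'
    linarith
  calc _ ≤ absVal (polyEmb (Q 1 0)) * absVal (polyEmb (Q 1 1) * G - polyEmb (Q 0 1)) := by
        have := fracNorm_le (polyEmb (Q 1 1) * G) (Q 0 1)
        have := fracNorm_nonneg (polyEmb (Q 1 1) * G)
        gcongr
    _ = 1 := hval

/-- Descent along the continued fraction: with s = r - q a₀ and G the next complete quotient, 2 |qF
- r| = |sG - q|. If deg s < deg q, then |q| ≥ 2|s| and the bound for (s, q) passes to (q, r).
Otherwise sG dominates q, or s = 0, and the bound is immediate. -/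
lemma HasContFrac.one_half_le {F : LaurentSeries K} {a : ℕ → K[X]} (hF : HasContFrac F a)
    (ha : ∀ n, (a n).natDegree = 1) {q : K[X]} (hq : q ≠ 0) (r : K[X]) :
    1 / 2 ≤ absVal (polyEmb q) * absVal (polyEmb q * F - polyEmb r) := by
  induction hn : q.natDegree using Nat.strong_induction_on generalizing F a q r with
  | _ n ih =>
  subst hn
  have hF1 := hF.drop 1
  have habs : absVal (completeQuotient F 1) = 2 := by
    rw [hF1.absVal_eq fun _ => (ha _).ge, absVal_polyEmb (ne_zero_of_natDegree_gt
      (n := 0) (by simp [seqDrop, ha])), seqDrop, ha, pow_one]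
  have hhead := hF.eq_head_add
  set G := completeQuotient F 1
  have hG0 : G ≠ 0 := ne_zero_of_two_le_absVal habs.ge
  have hq1 := one_le_absVal_polyEmb hq
  set s := r - q * a 0 with hs
  have hmul : absVal (polyEmb q * F - polyEmb r) * 2 = absVal (polyEmb s * G - polyEmb q) := by
    rw [← habs, ← absVal_mul, ← absVal_neg, hhead]
    congr 1
    rw [hs, map_sub, map_mul]
    field_simp
    ring
  by_cases hs0 : s = 0
  · rw [hs0, map_zero, zero_mul, zero_sub, absVal_neg] at hmul
    nlinarith
  have hs1 := one_le_absVal_polyEmb hs0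
  by_cases hdeg : s.natDegree < q.natDegree
  · have h := ih _ hdeg hF1 (fun _ => ha _) hs0 q rfl
    have hlt := (absVal_polyEmb_lt_iff hs0 hq).mpr hdeg
    have h2 : 2 * absVal (polyEmb s) ≤ absVal (polyEmb q) := by
      rw [absVal_polyEmb hs0, absVal_polyEmb hq, ← pow_succ']
      exact pow_le_pow_right₀ (by norm_num) hdeg
    rw [← hmul] at h
    nlinarith [absVal_nonneg (polyEmb q * F - polyEmb r)]
  · have hle : absVal (polyEmb q) ≤ absVal (polyEmb s) := by
      rw [← not_lt, absVal_polyEmb_lt_iff hs0 hq]; exact hdeg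
    have e : absVal (polyEmb s * G - polyEmb q) = absVal (polyEmb s) * 2 := by
      rw [sub_eq_add_neg, absVal_add_eq_left, absVal_mul, habs]
      rw [absVal_mul, habs, absVal_neg]
      linarith
    rw [e] at hmul
    nlinarith

lemma HasContFrac.badlyApproximable {F : LaurentSeries K} {a : ℕ → K[X]} (hF : HasContFrac F a)
    (ha : ∀ n, (a n).natDegree = 1) : BadlyApproximable F := by
  have : Nonempty {q : K[X] // q ≠ 0} := ⟨⟨1, one_ne_zero⟩⟩
  refine lt_of_lt_of_le (by norm_num : (0 : ℝ) < 1 / 2) (le_ciInf fun q => ?_)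
  exact hF.one_half_le ha q.2 _

lemma HasContFrac.not_rational {F : LaurentSeries K} {a : ℕ → K[X]} (hF : HasContFrac F a)
    (ha : ∀ n, (a n).natDegree = 1) {q r : K[X]} (h : polyEmb q * F = polyEmb r) : q = 0 := by
  by_contra hq
  have := hF.one_half_le ha hq r
  rw [h, sub_self, absVal_zero] at this
  norm_num at this

end Approximation

/-! ### The matrix identity behind the Frobenius relation. -/

section ThetaMatrix

variable {R : Type*} [CommRing R]

/-- For `s * t = 1`, the conjugate of a matrix by `diag(1, t)`. -/
def diagConj (s t : R) (Q : Matrix (Fin 2) (Fin 2) R) : Matrix (Fin 2) (Fin 2) R :=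
  !![Q 0 0, s * Q 0 1; t * Q 1 0, Q 1 1]

lemma diagConj_mul {s t : R} (h : s * t = 1) (P Q : Matrix (Fin 2) (Fin 2) R) :
    diagConj s t (P * Q) = diagConj s t P * diagConj s t Q := by
  ext i j : 1
  fin_cases i <;> fin_cases j <;> simp [diagConj, Matrix.mul_apply, Fin.sum_univ_two]
  · linear_combination -P 0 1 * Q 1 0 * h
  · ring
  · ring
  · linear_combination -P 1 0 * Q 0 1 * h

lemma diagConj_pow {s t : R} (h : s * t = 1) (Q : Matrix (Fin 2) (Fin 2) R) (n : ℕ) :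
    diagConj s t (Q ^ n) = diagConj s t Q ^ n := by
  induction n with
  | zero =>
    ext i j : 1
    fin_cases i <;> fin_cases j <;> simp [diagConj]
  | succ n ih => rw [pow_succ, pow_succ, diagConj_mul h, ih]

/-- The matrix of the word `x, (s x, t x)ⁿ, - s x, (-x, -x)ⁿ`, where `Q` is that of the word
`(x, x)ⁿ`. -/
def blockMat (s t x : R) (Q : Matrix (Fin 2) (Fin 2) R) : Matrix (Fin 2) (Fin 2) R :=
  !![x, 1; 1, 0] * diagConj s t Q * !![-(s * x), 1; 1, 0] * diagConj (-1) (-1) Q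

lemma mapMatrix_blockMat {S : Type*} [CommRing S] (f : R →+* S) (s t x : R)
    (Q : Matrix (Fin 2) (Fin 2) R) :
    f.mapMatrix (blockMat s t x Q) = blockMat (f s) (f t) (f x) (f.mapMatrix Q) := by
  rw [blockMat, blockMat, map_mul, map_mul, map_mul]
  congr 1
  · congr 1
    · congr 1
      · ext i j : 1
        fin_cases i <;> fin_cases j <;> simp
      · ext i j : 1
        fin_cases i <;> fin_cases j <;> simp [diagConj]
    · ext i j : 1
      fin_cases i <;> fin_cases j <;> simp
  · ext i j : 1
    fin_cases i <;> fin_cases j <;> simp [diagConj]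

/-- A polynomial identity, used with x = X, g = f_{p-1}, h = f_{p-2}. Then x g + 2 h = X^p is the
trace of M^p, and `hgh` says that M^(p-1) has determinant 1. The two matrices in a and b are the
powers of M and N computed in `exists_cfMat_pow_eq`. -/
lemma blockMat_intertwine {s x g h : R} (hs : s * 3 = 1) (hgh : g ^ 2 - x * g * h - h ^ 2 = 1)
    (a b : R) :
    blockMat s 3 x !![b * g, a + b * h; a + b * h, -a * x + b * (g - x * h)] * !![1, h; 0, g] =
      !![1, h; 0, g] * blockMat s 3 (x * g + 2 * h) !![b, a; a, b - a * (x * g + 2 * h)] := by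
  ext i j : 1
  fin_cases i <;> fin_cases j <;>
    simp [blockMat, diagConj, Matrix.mul_apply, Fin.sum_univ_two]
  · grind
  · grind
  · grind
  · grind

end ThetaMatrix

/-! ### The polynomials f_k as entries of powers of M, and the Frobenius relation. -/

section MillsRobbinsSeries

variable (p : ℕ) [Fact p.Prime]

/-- The longer range lets the three sums of the recurrence be compared term by term; the added
binomial coefficients vanish, whatever the truncated exponent. -/
lemma mrF_eq_sum_range_succ (k : ℕ) :
    mrF p k = ∑ j ∈ Finset.range (k + 1),
      C (((k - j).choose j : ℕ) : ZMod p) * X ^ (k - 2 * j) := by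
  rw [mrF]
  apply Finset.sum_subset
  · intro j; simp only [Finset.mem_range]; omega
  · intro j _ hj
    simp only [Finset.mem_range] at hj
    rw [Nat.choose_eq_zero_of_lt (by omega)]
    simp

lemma mrF_zero : mrF p 0 = 1 := by simp [mrF]

lemma mrF_one : mrF p 1 = X := by simp [mrF]

lemma mrF_add_two (k : ℕ) : mrF p (k + 2) = X * mrF p (k + 1) + mrF p k := by
  rw [mrF_eq_sum_range_succ p (k + 2), mrF_eq_sum_range_succ p (k + 1),
    mrF_eq_sum_range_succ p k, Finset.sum_range_succ' _ (k + 2), Finset.sum_range_succ _ (k + 1),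
    Finset.sum_range_succ' _ (k + 1), mul_add X, Finset.mul_sum]
  have h : ∀ i ∈ Finset.range (k + 1),
      C (((k + 2 - (i + 1)).choose (i + 1) : ℕ) : ZMod p) * X ^ (k + 2 - 2 * (i + 1)) =
      X * (C (((k + 1 - (i + 1)).choose (i + 1) : ℕ) : ZMod p) * X ^ (k + 1 - 2 * (i + 1))) +
      C (((k - i).choose i : ℕ) : ZMod p) * X ^ (k - 2 * i) := by
    intro i hi
    rw [Finset.mem_range] at hi
    rw [show k + 2 - (i + 1) = (k - i) + 1 by omega, Nat.choose_succ_succ,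
      show k + 1 - (i + 1) = k - i by omega, show k + 2 - 2 * (i + 1) = k - 2 * i by omega,
      Nat.cast_add, C_add]
    by_cases h2 : 2 * i < k
    -- When 2i ≥ k the subtraction is truncated and the exponents no longer match, but then the
    -- binomial coefficient is 0.
    · rw [show k - 2 * i = (k + 1 - 2 * (i + 1)) + 1 by omega, pow_succ]; ring
    · rw [Nat.choose_eq_zero_of_lt (show k - i < i + 1 by omega)]; simp
  rw [Finset.sum_congr rfl h, Finset.sum_add_distrib]
  simp [pow_succ]
  ring

lemma cfMat_X_pow (n : ℕ) : (cfMat X : Matrix (Fin 2) (Fin 2) (ZMod p)[X]) ^ (n + 2) =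
    !![mrF p (n + 2), mrF p (n + 1); mrF p (n + 1), mrF p n] := by
  induction n with
  | zero =>
    rw [mrF_add_two, zero_add, mrF_one, mrF_zero, pow_two, cfMat]
    ext i j : 1
    fin_cases i <;> fin_cases j <;> simp [Matrix.mul_apply, Fin.sum_univ_two]
  | succ n ih =>
    rw [show n + 1 + 2 = n + 2 + 1 by ring, pow_succ, ih, cfMat,
      show mrF p (n + 2 + 1) = X * mrF p (n + 2) + mrF p (n + 1) from mrF_add_two p (n + 1),
      mrF_add_two p n]
    ext i j : 1
    fin_cases i <;> fin_cases j <;> simp [Matrix.mul_apply, Fin.sum_univ_two] <;> ring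

lemma cfMat_sq {K : Type*} [Field K] (a : K[X]) :
    cfMat a ^ 2 = a • cfMat a + 1 := by
  rw [pow_two, cfMat]
  ext i j : 1
  fin_cases i <;> fin_cases j <;> simp [Matrix.mul_apply, Fin.sum_univ_two]

/-- The p-th power of M² = XM + 1; the summands commute, so it is additive in characteristic p. -/
lemma cfMat_X_pow_char_sq : (cfMat (X : (ZMod p)[X]) ^ p) ^ 2 =
    (X ^ p : (ZMod p)[X]) • cfMat (X : (ZMod p)[X]) ^ p + 1 := by
  have h := cfMat_sq (X : (ZMod p)[X])
  have h2 := congrArg (· ^ p) h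
  rw [add_pow_char_of_commute _ (Commute.one_right _), one_pow, _root_.smul_pow, ← pow_mul,
    mul_comm, pow_mul] at h2
  exact h2

lemma natDegree_mrF (k : ℕ) : (mrF p k).natDegree = k ∧ (mrF p k).Monic := by
  induction k using Nat.strong_induction_on with
  | _ k ih =>
  match k with
  | 0 => simp [mrF_zero]
  | 1 => simp [mrF_one, monic_X]
  | k + 2 =>
    obtain ⟨h1, m1⟩ := ih (k + 1) (by omega)
    obtain ⟨h0, m0⟩ := ih k (by omega)
    have hX : (X * mrF p (k + 1)).Monic := monic_X.mul m1
    have hXd : (X * mrF p (k + 1)).natDegree = k + 2 := by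
      rw [monic_X.natDegree_mul m1, h1, natDegree_X]; ring
    have hlt : (mrF p k).degree < (X * mrF p (k + 1)).degree := by
      rw [degree_eq_natDegree hX.ne_zero, degree_eq_natDegree m0.ne_zero, hXd, h0]
      exact_mod_cast (by omega : k < k + 2)
    rw [mrF_add_two]
    exact ⟨by rw [natDegree_add_eq_left_of_degree_lt hlt, hXd], hX.add_of_left hlt⟩


/-- The trace and the determinant of the `p`-th power of the matrix of `X`. -/
lemma X_pow_char_eq_and_det (hp : 2 ≤ p) :
    (X : (ZMod p)[X]) ^ p = X * mrF p (p - 1) + 2 * mrF p (p - 2) ∧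
      mrF p (p - 1) ^ 2 - X * mrF p (p - 1) * mrF p (p - 2) - mrF p (p - 2) ^ 2 = 1 := by
  have hpow := cfMat_X_pow p (p - 2)
  have hrec := mrF_add_two p (p - 2)
  have h := cfMat_X_pow_char_sq p
  have h1 : p - 2 + 1 = p - 1 := by omega
  have h2 : p - 2 + 2 = p := by omega
  rw [h1] at hpow hrec
  rw [h2] at hpow hrec
  rw [hpow] at h
  have hg := (natDegree_mrF p (p - 1)).2.ne_zero
  set g := mrF p (p - 1)
  set f := mrF p (p - 2)
  have e01 := congrFun (congrFun h 0) 1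
  have e00 := congrFun (congrFun h 0) 0
  simp [pow_two, Matrix.mul_apply, Fin.sum_univ_two] at e01 e00
  rw [hrec] at e01 e00
  -- With P = M^p, the (0, 1) entry of P² = X^p P + 1 reads tr(P) P₀₁ = X^p P₀₁, and P₀₁ = f_{p-1}
  -- is nonzero. The (0, 0) entry then gives the determinant.
  have ht : (X : (ZMod p)[X]) ^ p = X * g + 2 * f := by
    apply mul_right_cancel₀ hg
    linear_combination -e01
  refine ⟨ht, ?_⟩
  rw [ht] at e00
  linear_combination e00

/-- The powers of two matrices with the same quadratic equation are given by the same
linear combinations. -/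
lemma exists_pow_eq_of_sq {S A B : Type*} [CommRing S] [Ring A] [Algebra S A] [Ring B]
    [Algebra S B] {x : S} {P : A} {Q : B} (hP : P ^ 2 = x • P + 1) (hQ : Q ^ 2 = x • Q + 1)
    (n : ℕ) : ∃ a b : S, P ^ n = a • (1 : A) + b • P ∧ Q ^ n = a • (1 : B) + b • Q := by
  induction n with
  | zero => exact ⟨1, 0, by simp, by simp⟩
  | succ n ih =>
    obtain ⟨a, b, h1, h2⟩ := ih
    refine ⟨b, a + b * x, ?_, ?_⟩
    · rw [pow_succ, h1, add_mul, smul_mul_assoc, smul_mul_assoc, one_mul, ← pow_two, hP]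
      module
    · rw [pow_succ, h2, add_mul, smul_mul_assoc, smul_mul_assoc, one_mul, ← pow_two, hQ]
      module

lemma cfMat_inv_mul {K : Type*} [Field K] (a : K[X]) : !![0, 1; 1, -a] * cfMat a = 1 := by
  ext i j : 1
  fin_cases i <;> fin_cases j <;> simp [cfMat, Matrix.mul_apply, Fin.sum_univ_two]

/-- M^(p^(k+1)) = (M^p)^(p^k) and N^(p^k) have the same coordinates a, b in the bases 1, M^p and 1,
N. One factor M, respectively N, is then cancelled, because L_k has p^k - 1 letters; M^(p-1) brings
in f_{p-1} and f_{p-2}. -/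
lemma exists_cfMat_pow_eq (hp : 2 ≤ p) (k : ℕ) : ∃ a b : (ZMod p)[X],
    cfMat (X : (ZMod p)[X]) ^ (p ^ (k + 1) - 1) =
      !![b * mrF p (p - 1), a + b * mrF p (p - 2); a + b * mrF p (p - 2),
        -a * X + b * (mrF p (p - 1) - X * mrF p (p - 2))] ∧
    cfMat (X ^ p : (ZMod p)[X]) ^ (p ^ k - 1) = !![b, a; a, b - a * X ^ p] := by
  obtain ⟨a, b, h1, h2⟩ := exists_pow_eq_of_sq (cfMat_X_pow_char_sq p)
    (cfMat_sq (X ^ p : (ZMod p)[X])) (p ^ k)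
  have hk : ∀ m, p ^ m - 1 + 1 = p ^ m := fun m =>
    Nat.sub_add_cancel (Nat.one_le_pow _ _ (by omega))
  have hpow := cfMat_X_pow p (p - 2)
  have hrec := mrF_add_two p (p - 2)
  rw [show p - 2 + 1 = p - 1 by omega, show p - 2 + 2 = p by omega] at hpow hrec
  refine ⟨a, b, ?_, ?_⟩
  · rw [← one_mul (cfMat X ^ (p ^ (k + 1) - 1)), ← cfMat_inv_mul, mul_assoc, ← pow_succ', hk,
      pow_succ', pow_mul, h1, hpow, hrec]
    ext i j : 1
    fin_cases i <;> fin_cases j <;> simp [Matrix.mul_apply, Fin.sum_univ_two] <;> ring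
  · rw [← one_mul (cfMat (X ^ p) ^ (p ^ k - 1)), ← cfMat_inv_mul, mul_assoc, ← pow_succ', hk, h2]
    ext i j : 1
    fin_cases i <;> fin_cases j <;> simp [cfMat, Matrix.mul_apply, Fin.sum_univ_two] <;> ring

lemma three_ne_zero_zmod (hp : 5 ≤ p) : (3 : ZMod p) ≠ 0 := by
  intro h
  have h' : ((3 : ℕ) : ZMod p) = 0 := by exact_mod_cast h
  rw [ZMod.natCast_eq_zero_iff] at h'
  exact absurd (Nat.le_of_dvd (by norm_num) h') (by omega)

lemma C_three_inv_mul_three (hp : 5 ≤ p) : C (3 : ZMod p)⁻¹ * 3 = 1 := by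
  rw [← map_ofNat C 3, ← C_mul, inv_mul_cancel₀ (three_ne_zero_zmod p hp), C_1]

/-- The matrix of the word `X, L_k(3), -X/3, L_k(-1)`. -/
lemma cfMatProd_thetaBlock (hp : 5 ≤ p) (k : ℕ) : cfMatProd (thetaBlock p k) =
    blockMat (C (3 : ZMod p)⁻¹) 3 X (cfMat (X : (ZMod p)[X]) ^ (p ^ k - 1)) := by
  have h3 := C_three_inv_mul_three p hp
  have hodd : Odd (p ^ k) := ((Fact.out : p.Prime).odd_of_ne_two (by omega)).pow
  have hk : p ^ k - 1 = 2 * ((p ^ k - 1) / 2) := by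
    obtain ⟨m, hm⟩ := hodd
    omega
  -- For s t = 1 the pair sX, tX has as its matrix a diagonal conjugate of M². Since p^k - 1 is
  -- even, the whole word gives a conjugate of M^(p^k-1).
  have hword : ∀ s t : (ZMod p)[X], s * t = 1 →
      cfMatProd (List.replicate ((p ^ k - 1) / 2) [s * X, t * X]).flatten =
        diagConj s t (cfMat (X : (ZMod p)[X]) ^ (p ^ k - 1)) := by
    intro s t hst
    rw [cfMatProd_flatten_replicate, hk, pow_mul, diagConj_pow hst, ← hk]
    congr 1
    ext i j : 1
    fin_cases i <;> fin_cases j <;>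
      simp [cfMatProd, cfMat, diagConj, pow_two, Matrix.mul_apply, Fin.sum_univ_two]
    linear_combination X * X * hst
  have hneg := hword (-1) (-1) (by ring)
  rw [neg_one_mul] at hneg
  rw [thetaBlock, cfMatProd_cons, cfMatProd_append, cfMatProd_cons, wordLThree, wordLNegOne,
    xDivThree, hword _ _ h3, hneg, blockMat, cfMat, cfMat]
  simp only [mul_assoc]

/-- The Frobenius intertwines the matrices of consecutive blocks. -/
lemma blockMat_frobenius (hp : 5 ≤ p) (k : ℕ) :
    cfMatProd (thetaBlock p (k + 1)) * !![1, mrF p (p - 2); 0, mrF p (p - 1)] =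
      !![1, mrF p (p - 2); 0, mrF p (p - 1)] *
        (frobenius (ZMod p)[X] p).mapMatrix (cfMatProd (thetaBlock p k)) := by
  have h3 := C_three_inv_mul_three p hp
  obtain ⟨hX, hdet⟩ := X_pow_char_eq_and_det p (by omega)
  obtain ⟨a, b, h1, h2⟩ := exists_cfMat_pow_eq p (by omega) k
  have hmap : (frobenius (ZMod p)[X] p).mapMatrix (cfMat (X : (ZMod p)[X]) ^ (p ^ k - 1)) =
      !![b, a; a, b - a * X ^ p] := by
    rw [map_pow, ← h2]
    congr 1
    ext i j : 1
    fin_cases i <;> fin_cases j <;> simp [cfMat, frobenius_def, (Fact.out : p.Prime).ne_zero]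
  rw [cfMatProd_thetaBlock p hp (k + 1), cfMatProd_thetaBlock p hp k, h1, blockMat_intertwine h3 hdet, ← hX,
    ← hmap, mapMatrix_blockMat]
  have hC : frobenius (ZMod p)[X] p (C (3 : ZMod p)⁻¹) = C (3 : ZMod p)⁻¹ := by
    rw [frobenius_def, ← C_pow, ZMod.pow_card]
  rw [hC, map_ofNat, frobenius_def]

end MillsRobbinsSeries

/-! ### The series Θ: tails at block starts, and its algebraic equation. -/

section ThetaSeries

variable (p : ℕ) [Fact p.Prime]

/-- The concatenation of the blocks with index less than `k`. -/
noncomputable def thetaPrefix (k : ℕ) : List (ZMod p)[X] := (List.range k).flatMap (thetaBlock p)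

lemma thetaPrefix_succ (k : ℕ) : thetaPrefix p (k + 1) = thetaPrefix p k ++ thetaBlock p k := by
  simp [thetaPrefix, List.range_succ]

lemma thetaPrefix_isPrefix {k m : ℕ} (h : k ≤ m) : thetaPrefix p k <+: thetaPrefix p m := by
  induction m, h using Nat.le_induction with
  | base => exact List.prefix_rfl
  | succ m _ ih => exact ih.trans (thetaPrefix_succ p m ▸ List.prefix_append _ _)

lemma length_thetaBlock (k : ℕ) :
    (thetaBlock p k).length = 2 + 4 * ((p ^ k - 1) / 2) := by
  simp only [thetaBlock, wordLThree, wordLNegOne, List.length_cons, List.length_append,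
    List.length_flatten, List.map_replicate, List.length_nil, List.sum_replicate, smul_eq_mul]
  omega

lemma two_mul_le_length_thetaPrefix (k : ℕ) : 2 * k ≤ (thetaPrefix p k).length := by
  induction k with
  | zero => simp
  | succ k ih => rw [thetaPrefix_succ, List.length_append, length_thetaBlock]; omega

lemma thetaQuotients_eq {n m : ℕ} (h : n < (thetaPrefix p m).length) :
    thetaQuotients p n = (thetaPrefix p m)[n] := by
  have h1 : n < (thetaPrefix p (n + 1)).length := by
    have := two_mul_le_length_thetaPrefix p (n + 1); omega
  have h2 : thetaQuotients p n = (thetaPrefix p (n + 1))[n] := by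
    rw [thetaQuotients, ← thetaPrefix, List.getD_eq_getElem _ _ h1]
  rw [h2]
  rcases le_total m (n + 1) with hm | hm
  · exact ((thetaPrefix_isPrefix p hm).getElem h).symm
  · exact (thetaPrefix_isPrefix p hm).getElem h1

lemma map_range_thetaQuotients (k : ℕ) :
    (List.range (thetaPrefix p k).length).map (thetaQuotients p) = thetaPrefix p k := by
  apply List.ext_getElem
  · simp
  · intro n h1 h2
    simp only [List.getElem_map, List.getElem_range]
    exact thetaQuotients_eq p h2

lemma map_range_seqDrop_thetaQuotients (k : ℕ) :
    (List.range (thetaBlock p k).length).map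
      (seqDrop (thetaPrefix p k).length (thetaQuotients p)) = thetaBlock p k := by
  apply List.ext_getElem
  · simp
  · intro n h1 h2
    simp only [List.getElem_map, List.getElem_range, seqDrop]
    rw [thetaQuotients_eq p (m := k + 1)]
    · simp only [thetaPrefix_succ]
      rw [List.getElem_append_right (by omega)]
      simp
    · rw [thetaPrefix_succ, List.length_append]; omega

variable {p}

lemma degree_xDivThree (hp : 5 ≤ p) : (xDivThree p).degree = 1 :=
  Polynomial.degree_C_mul_X (inv_ne_zero (three_ne_zero_zmod p hp))

lemma degree_three_mul_X (hp : 5 ≤ p) : (3 * X : (ZMod p)[X]).degree = 1 := by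
  rw [← map_ofNat C 3]; exact Polynomial.degree_C_mul_X (three_ne_zero_zmod p hp)

lemma degree_mem_wordLThree (hp : 5 ≤ p) {k : ℕ} {a : (ZMod p)[X]} (ha : a ∈ wordLThree p k) :
    a.degree = 1 := by
  simp only [wordLThree, List.mem_flatten, List.mem_replicate] at ha
  obtain ⟨l, ⟨_, rfl⟩, h⟩ := ha
  rcases List.mem_pair.mp h with rfl | rfl
  · exact degree_xDivThree hp
  · exact degree_three_mul_X hp

lemma degree_mem_thetaBlock (hp : 5 ≤ p) {k : ℕ} {a : (ZMod p)[X]} (ha : a ∈ thetaBlock p k) :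
    a.degree = 1 := by
  simp only [thetaBlock, List.mem_cons, List.mem_append] at ha
  rcases ha with rfl | ha | rfl | ha
  · exact degree_X
  · exact degree_mem_wordLThree hp ha
  · rw [degree_neg]; exact degree_xDivThree hp
  · simp only [wordLNegOne, List.mem_flatten, List.mem_replicate] at ha
    obtain ⟨l, ⟨_, rfl⟩, h⟩ := ha
    rcases List.mem_pair.mp h with rfl | rfl <;> rw [degree_neg, degree_X]

lemma degree_mem_thetaPrefix (hp : 5 ≤ p) {k : ℕ} {a : (ZMod p)[X]} (ha : a ∈ thetaPrefix p k) :
    a.degree = 1 := by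
  simp only [thetaPrefix, List.mem_flatMap] at ha
  obtain ⟨j, _, h⟩ := ha
  exact degree_mem_thetaBlock hp h

lemma natDegree_thetaQuotients (hp : 5 ≤ p) (n : ℕ) : (thetaQuotients p n).natDegree = 1 := by
  have h : n < (thetaPrefix p (n + 1)).length := by
    have := two_mul_le_length_thetaPrefix p (n + 1); omega
  rw [thetaQuotients_eq p h]
  exact natDegree_eq_of_degree_eq_some (degree_mem_thetaPrefix hp (List.getElem_mem h))

lemma natDegree_phiQuotients (hp : 5 ≤ p) (n : ℕ) : (phiQuotients p n).natDegree = 1 := by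
  rw [phiQuotients]
  split_ifs
  · exact natDegree_eq_of_degree_eq_some (degree_three_mul_X hp)
  · exact natDegree_eq_of_degree_eq_some (degree_xDivThree hp)

instance charP_laurentSeries : CharP (LaurentSeries (ZMod p)) p :=
  charP_of_injective_ringHom polyEmb_injective p

lemma MobiusRel.frobenius {Q : Matrix (Fin 2) (Fin 2) (ZMod p)[X]}
    {F G : LaurentSeries (ZMod p)} (h : MobiusRel Q F G) :
    MobiusRel ((frobenius (ZMod p)[X] p).mapMatrix Q) (F ^ p) (G ^ p) := by
  obtain ⟨c, hc, h1, h2⟩ := h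
  refine ⟨c ^ p, pow_ne_zero _ hc, ?_, ?_⟩
  · simp only [RingHom.mapMatrix_apply, Matrix.map_apply, frobenius_def, map_pow]
    rw [← mul_pow, ← add_pow_char, h1, mul_pow]
  · simp only [RingHom.mapMatrix_apply, Matrix.map_apply, frobenius_def, map_pow]
    rw [← mul_pow, ← add_pow_char, h2]

/-- The tails of the series at the starts of the blocks. -/
noncomputable def thetaTail (Θ : LaurentSeries (ZMod p)) (k : ℕ) : LaurentSeries (ZMod p) :=
  completeQuotient Θ (thetaPrefix p k).length

variable {Θ : LaurentSeries (ZMod p)}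

lemma thetaTail_zero : thetaTail Θ 0 = Θ := rfl

lemma thetaTail_eq_cfEval (hΘ : HasContFrac Θ (thetaQuotients p)) (k : ℕ) :
    thetaTail Θ k = cfEval (thetaBlock p k) (thetaTail Θ (k + 1)) := by
  have h := (hΘ.drop (thetaPrefix p k).length).eq_cfEval (thetaBlock p k).length
  rwa [map_range_seqDrop_thetaQuotients, ← completeQuotient_add, ← List.length_append,
    ← thetaPrefix_succ] at h

lemma absVal_thetaTail (hp : 5 ≤ p) (hΘ : HasContFrac Θ (thetaQuotients p)) (k : ℕ) :
    absVal (thetaTail Θ k) = 2 := by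
  rw [thetaTail, (hΘ.drop _).absVal_eq fun _ => (natDegree_thetaQuotients hp _).ge, seqDrop,
    absVal_polyEmb (ne_zero_of_natDegree_gt (n := 0) (by simp [natDegree_thetaQuotients hp])),
    natDegree_thetaQuotients hp, pow_one]

/-- The map `Z ↦ (Z ^ p + f_(p-2)) / f_(p-1)`. -/
noncomputable def frobStep (F : LaurentSeries (ZMod p)) : LaurentSeries (ZMod p) :=
  (F ^ p + polyEmb (mrF p (p - 2))) / polyEmb (mrF p (p - 1))

lemma mobiusRel_frobStep (F : LaurentSeries (ZMod p)) :
    MobiusRel !![1, mrF p (p - 2); 0, mrF p (p - 1)] (F ^ p) (frobStep F) := by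
  have h := polyEmb_ne_zero (natDegree_mrF p (p - 1)).2.ne_zero
  refine ⟨polyEmb (mrF p (p - 1)), h, ?_, ?_⟩
  · simp [frobStep, mul_div_cancel₀ _ h]
  · simp

lemma absVal_frobStep (hp : 5 ≤ p) {F : LaurentSeries (ZMod p)} (hF : absVal F = 2) :
    absVal (frobStep F) = 2 := by
  obtain ⟨h1, m1⟩ := natDegree_mrF p (p - 1)
  obtain ⟨h2, m2⟩ := natDegree_mrF p (p - 2)
  rw [frobStep, absVal_div, absVal_add_eq_left, absVal_pow, hF, absVal_polyEmb m1.ne_zero, h1,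
    div_eq_iff (by positivity), ← pow_succ', Nat.sub_add_cancel (by omega)]
  rw [absVal_pow, hF, absVal_polyEmb m2.ne_zero, h2]
  exact pow_lt_pow_right₀ (by norm_num) (by omega)

/-- Apply the Frobenius to Θ_k = B_k·Θ_{k+1}, then D, and move D past the block with
`blockMat_frobenius`. -/
lemma frobStep_thetaTail_eq_cfEval (hp : 5 ≤ p) (hΘ : HasContFrac Θ (thetaQuotients p)) (k : ℕ) :
    frobStep (thetaTail Θ k) =
      cfEval (thetaBlock p (k + 1)) (frobStep (thetaTail Θ (k + 1))) := by
  have hblock : ∀ k, ∀ a ∈ thetaBlock p k, 1 ≤ a.natDegree := fun k a ha =>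
    (natDegree_eq_of_degree_eq_some (degree_mem_thetaBlock hp ha)).ge
  have h1 := mobiusRel_cfMatProd (hblock k) (absVal_thetaTail hp hΘ (k + 1)).ge
  rw [← thetaTail_eq_cfEval hΘ k] at h1
  have h2 := (mobiusRel_frobStep (thetaTail Θ k)).comp h1.frobenius
  rw [← blockMat_frobenius p hp k] at h2
  have h3 := h2.of_comp (mobiusRel_frobStep (thetaTail Θ (k + 1)))
  exact h3.right_unique (mobiusRel_cfMatProd (hblock (k + 1))
    (absVal_frobStep hp (absVal_thetaTail hp hΘ (k + 1))).ge)

theorem frobStep_thetaTail (hp : 5 ≤ p) (hΘ : HasContFrac Θ (thetaQuotients p)) (k : ℕ) :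
    frobStep (thetaTail Θ k) = thetaTail Θ (k + 1) := by
  have hblock : ∀ k, ∀ a ∈ thetaBlock p k, 1 ≤ a.natDegree := fun k a ha =>
    (natDegree_eq_of_degree_eq_some (degree_mem_thetaBlock hp ha)).ge
  have hS : ∀ k, absVal (frobStep (thetaTail Θ k)) = 2 := fun k =>
    absVal_frobStep hp (absVal_thetaTail hp hΘ k)
  -- Both sides have norm 2 for every k and obey the same recursion, so the difference at k is at
  -- most a quarter of the one at k + 1. The induction is thus over all k at once.
  refine eq_of_forall_absVal_sub_le (C := 2) fun n => ?_
  induction n generalizing k with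
  | zero =>
    have h := absVal_sub_le_max (frobStep (thetaTail Θ k)) (thetaTail Θ (k + 1))
    rw [hS, absVal_thetaTail hp hΘ, max_self] at h
    simpa using h
  | succ n ih =>
    have e := frobStep_thetaTail_eq_cfEval hp hΘ k
    have e' := thetaTail_eq_cfEval hΘ (k + 1)
    have h := absVal_cfEval_sub_le (hblock (k + 1)) (hS (k + 1)).ge
      (absVal_thetaTail hp hΘ (k + 1 + 1)).ge
    have h4 : (4 : ℝ) ≤ 4 ^ (thetaBlock p (k + 1)).length :=
      le_self_pow₀ (by norm_num) (by rw [length_thetaBlock]; omega)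
    rw [← e, ← e'] at h
    refine h.trans ?_
    calc
      _ ≤ absVal (frobStep (thetaTail Θ (k + 1)) - thetaTail Θ (k + 1 + 1)) / 4 :=
        div_le_div_of_nonneg_left (absVal_nonneg _) (by norm_num) h4
      _ ≤ 2 / 4 ^ n / 4 := div_le_div_of_nonneg_right (ih (k + 1)) (by norm_num)
      _ = 2 / 4 ^ (n + 1) := by rw [pow_succ, div_div]

theorem mrPoly_eval (hp : 5 ≤ p) (hΘ : HasContFrac Θ (thetaQuotients p)) :
    (mrPoly p).eval₂ polyEmb Θ = 0 := by
  have h0 := thetaTail_eq_cfEval hΘ 0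
  have h1 := frobStep_thetaTail hp hΘ 0
  have hT := absVal_thetaTail hp hΘ 1
  simp only [zero_add, thetaTail_zero] at h0 h1 hT
  have h3 : (3 : LaurentSeries (ZMod p)) ≠ 0 := by
    have := polyEmb_ne_zero (C_ne_zero.mpr (three_ne_zero_zmod p hp))
    rwa [map_ofNat, map_ofNat] at this
  have hs : polyEmb (C (3 : ZMod p)⁻¹) = (3 : LaurentSeries (ZMod p))⁻¹ := by
    have := congrArg polyEmb (C_three_inv_mul_three p hp)
    rw [map_mul, map_ofNat, map_one] at this
    exact eq_inv_of_mul_eq_one_left this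
  have hg := polyEmb_ne_zero (natDegree_mrF p (p - 1)).2.ne_zero
  have hT0 := ne_zero_of_two_le_absVal hT.ge
  have hb : ∀ a ∈ [-xDivThree p], 1 ≤ a.natDegree := by
    intro a ha
    rw [List.mem_singleton.mp ha, natDegree_neg]
    exact (natDegree_eq_of_degree_eq_some (degree_xDivThree hp)).ge
  have hU := two_le_absVal_cfEval hb hT.ge
  have hU0 := ne_zero_of_two_le_absVal hU
  -- The words L_0 are empty, so this block is X, -X/3 and `h0` becomes Θ = [X, -X/3, Θ_1].
  simp only [thetaBlock, wordLThree, wordLNegOne, pow_zero, Nat.sub_self, Nat.zero_div,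
    List.replicate_zero, List.flatten_nil, List.nil_append, cfEval_cons, cfEval_nil,
    xDivThree, map_neg, map_mul, hs] at h0 hU0
  rw [frobStep, div_eq_iff hg] at h1
  set x := polyEmb (X : (ZMod p)[X])
  set T := thetaTail Θ 1
  have key : (Θ - x) * (3 - x * T) = 3 * T := by
    have hmul : (Θ - x) * (-(3⁻¹ * x) + T⁻¹) = 1 := by
      rw [h0, add_sub_cancel_left, inv_mul_cancel₀ hU0]
    have e : (-(3⁻¹ * x) + T⁻¹) * (3 * T) = 3 - x * T := by field_simp; ring
    rw [← e, ← mul_assoc, hmul, one_mul]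
  simp only [mrPoly, eval₂_add, eval₂_sub, eval₂_mul, eval₂_C, eval₂_pow, eval₂_X]
  simp only [map_add, map_sub, map_mul, map_neg, map_pow, map_ofNat]
  linear_combination (x * Θ - (x ^ 2 - 3)) * h1 - polyEmb (mrF p (p - 1)) * key

end ThetaSeries

/-! ### The quadratic series Φ and the Littlewood property. -/

section LittlewoodProperty

variable {p : ℕ} [Fact p.Prime] {Θ Φ : LaurentSeries (ZMod p)}

lemma seqDrop_two_phiQuotients : seqDrop 2 (phiQuotients p) = phiQuotients p := by
  funext n
  simp [seqDrop, phiQuotients, Nat.even_add]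

/-- By periodicity and uniqueness, the complete quotient of Φ after two steps is Φ itself. -/
lemma phi_eq_and_drop_eq (hp : 5 ≤ p) (hΦ : HasContFrac Φ (phiQuotients p)) :
    Φ = polyEmb (3 * X) + (completeQuotient Φ 1)⁻¹ ∧
      completeQuotient Φ 1 = polyEmb (xDivThree p) + Φ⁻¹ := by
  have h0 := hΦ.eq_head_add
  have h1 := (hΦ.drop 1).eq_head_add
  have h2 := hΦ.drop 2
  rw [seqDrop_two_phiQuotients] at h2
  have h3 := h2.unique hΦ fun n => (natDegree_phiQuotients hp n).ge
  rw [← completeQuotient_add, h3] at h1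
  refine ⟨?_, ?_⟩
  · simpa [phiQuotients] using h0
  · simpa [phiQuotients, seqDrop] using h1

lemma absVal_drop_phi (hp : 5 ≤ p) (hΦ : HasContFrac Φ (phiQuotients p)) (n : ℕ) :
    absVal (completeQuotient Φ n) = 2 := by
  rw [(hΦ.drop n).absVal_eq fun _ => (natDegree_phiQuotients hp _).ge, seqDrop,
    absVal_polyEmb (ne_zero_of_natDegree_gt (n := 0) (by simp [natDegree_phiQuotients hp])),
    natDegree_phiQuotients hp, pow_one]

lemma phi_sq (hp : 5 ≤ p) (hΦ : HasContFrac Φ (phiQuotients p)) :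
    Φ ^ 2 - polyEmb (3 * X) * Φ - 9 = 0 := by
  obtain ⟨h0, h1⟩ := phi_eq_and_drop_eq hp hΦ
  have hΨ0 := ne_zero_of_two_le_absVal (absVal_drop_phi hp hΦ 1).ge
  have hΦ0 := ne_zero_of_two_le_absVal (absVal_drop_phi hp hΦ 0).ge
  rw [completeQuotient] at hΦ0
  set Ψ := completeQuotient Φ 1
  have hs : 3 * polyEmb (C (3 : ZMod p)⁻¹) = 1 := by
    have := congrArg polyEmb (C_three_inv_mul_three p hp)
    rw [map_mul, map_ofNat, map_one] at this
    rw [mul_comm, this]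
  rw [xDivThree] at h1
  rw [map_mul, map_ofNat] at h0 ⊢
  rw [map_mul] at h1
  set x := polyEmb (X : (ZMod p)[X])
  have e0 : Φ * Ψ = 3 * x * Ψ + 1 := by
    conv_lhs => rw [h0]
    field_simp
  have e1 : Ψ * Φ = polyEmb (C (3 : ZMod p)⁻¹) * x * Φ + 1 := by
    conv_lhs => rw [h1]
    field_simp
  have hx0 : x ≠ 0 := polyEmb_ne_zero X_ne_zero
  -- The two expressions for ΦΨ give 3xΨ = xΦ/3.
  have e2 : 9 * Ψ = Φ := by
    apply mul_left_cancel₀ hx0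
    linear_combination 3 * e1 - 3 * e0 + x * Φ * hs
  linear_combination 9 * e0 + (3 * x - Φ) * e2

/-- The deviation of the quotient of the last two denominators of the word `l` from `Φ`. -/
noncomputable def denomError (Φ : LaurentSeries (ZMod p)) (l : List (ZMod p)[X]) :
    LaurentSeries (ZMod p) :=
  polyEmb (cfMatProd l 1 0) - Φ * polyEmb (cfMatProd l 1 1)

/-- Appending the period divides the deviation exactly by ΨΦ, where Ψ = [X/3, Φ]: the vector (1, -Φ)
is an eigenvector of the period. Both factors have norm 2. -/
lemma absVal_denomError_append (hp : 5 ≤ p) (hΦ : HasContFrac Φ (phiQuotients p))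
    (l : List (ZMod p)[X]) :
    absVal (denomError Φ (l ++ [xDivThree p, 3 * X])) = absVal (denomError Φ l) / 4 := by
  obtain ⟨h0, h1⟩ := phi_eq_and_drop_eq hp hΦ
  have hΨ := absVal_drop_phi hp hΦ 1
  have hΦ2 := absVal_drop_phi hp hΦ 0
  rw [completeQuotient] at hΦ2
  have hΨ0 := ne_zero_of_two_le_absVal hΨ.ge
  have hΦ0 := ne_zero_of_two_le_absVal hΦ2.ge
  set Ψ := completeQuotient Φ 1
  have e : denomError Φ (l ++ [xDivThree p, 3 * X]) * (Ψ * Φ) = denomError Φ l := by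
    rw [denomError, denomError,
      show l ++ [xDivThree p, 3 * X] = (l ++ [xDivThree p]) ++ [3 * X] by simp,
      cfMatProd_concat_one_zero, cfMatProd_concat_one_one, cfMatProd_concat_one_one,
      cfMatProd_concat_one_zero]
    rw [map_add, map_mul, map_add, map_mul]
    have e0 : Φ * Ψ = polyEmb (3 * X) * Ψ + 1 := by
      conv_lhs => rw [h0]
      field_simp
    have e1 : Ψ * Φ = polyEmb (xDivThree p) * Φ + 1 := by
      conv_lhs => rw [h1]
      field_simp
    linear_combination -(polyEmb (cfMatProd l 1 0) * polyEmb (xDivThree p) +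
      polyEmb (cfMatProd l 1 1)) * Φ * e0 + polyEmb (cfMatProd l 1 0) * e1
  rw [← e, absVal_mul, absVal_mul, hΨ, hΦ2]
  ring

lemma absVal_denomError_append_replicate (hp : 5 ≤ p) (hΦ : HasContFrac Φ (phiQuotients p))
    (l : List (ZMod p)[X]) (n : ℕ) :
    absVal (denomError Φ (l ++ (List.replicate n [xDivThree p, 3 * X]).flatten)) =
      absVal (denomError Φ l) / 4 ^ n := by
  induction n with
  | zero => simp
  | succ n ih =>
    rw [List.replicate_succ', List.flatten_append, List.flatten_singleton, ← List.append_assoc,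
      absVal_denomError_append hp hΦ, ih, div_div, pow_succ]

lemma absVal_denomError_concat_le (hp : 5 ≤ p) (hΦ : HasContFrac Φ (phiQuotients p))
    {l : List (ZMod p)[X]} (hl : ∀ a ∈ l, a.degree = 1) {b : (ZMod p)[X]} (hb : b.degree = 1) :
    absVal (denomError Φ (l ++ [b])) ≤ 2 * 2 ^ l.length := by
  obtain ⟨h0, h1⟩ := degree_cfMatProd_concat hl hb
  have hΦ2 := absVal_drop_phi hp hΦ 0
  rw [completeQuotient] at hΦ2
  have hle : ∀ q : (ZMod p)[X], q.degree ≤ l.length → absVal (polyEmb q) ≤ 2 ^ l.length := by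
    intro q hq
    by_cases hq0 : q = 0
    · rw [hq0, map_zero, absVal_zero]; positivity
    · rw [absVal_polyEmb hq0]
      exact pow_le_pow_right₀ (by norm_num) (natDegree_le_of_degree_le hq)
  refine (absVal_sub_le_max _ _).trans (max_le ?_ ?_)
  · have := hle _ h0.le
    have : (0 : ℝ) < 2 ^ l.length := by positivity
    linarith
  · rw [absVal_mul, hΦ2]
    have := hle _ h1.le
    linarith

lemma odd_pow_prime (hp : 5 ≤ p) (k : ℕ) : Odd (p ^ k) :=
  ((Fact.out : p.Prime).odd_of_ne_two (by omega)).pow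

/-- Block j has 2p^j letters, so the length is 2(p^k - 1)/(p - 1), at most (p^k - 1)/2 as p ≥ 5.
This is what lets L_k(3) outweigh all that precedes it. -/
lemma two_mul_length_thetaPrefix_le (hp : 5 ≤ p) (k : ℕ) :
    2 * (thetaPrefix p k).length ≤ 2 * ((p ^ k - 1) / 2) := by
  induction k with
  | zero => simp [thetaPrefix]
  | succ k ih =>
    obtain ⟨m, hm⟩ := odd_pow_prime hp k
    have h5 : 5 * p ^ k ≤ p ^ (k + 1) := by rw [pow_succ']; gcongr
    rw [thetaPrefix_succ, List.length_append, length_thetaBlock]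
    omega

lemma cfEval_append {K : Type*} [Field K] (l l' : List K[X]) (F : LaurentSeries K) :
    cfEval (l ++ l') F = cfEval l (cfEval l' F) := by simp [cfEval]

/-- The word w ends with L_k(3), and q is the last denominator but one of w. Up to the letter X
before L_k(3) the deviation from Φ is at most 2·2^ℓ, with ℓ the length of the earlier blocks; each
pair of L_k(3) then divides it by 4. -/
lemma exists_littlewood_le (hp : 5 ≤ p) (hΘ : HasContFrac Θ (thetaQuotients p))
    (hΦ : HasContFrac Φ (phiQuotients p)) (k : ℕ) (hk : 1 ≤ k) :
    ∃ q : (ZMod p)[X], q ≠ 0 ∧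
      absVal (polyEmb q) * fracNorm (polyEmb q * Θ) * fracNorm (polyEmb q * Φ) ≤
        2 / 4 ^ k := by
  set w := thetaPrefix p k ++ [(X : (ZMod p)[X])] ++ wordLThree p k with hw
  have hdeg : ∀ a ∈ w, a.degree = 1 := by
    intro a ha
    simp only [hw, List.mem_append, List.mem_singleton] at ha
    rcases ha with (ha | rfl) | ha
    · exact degree_mem_thetaPrefix hp ha
    · exact degree_X
    · exact degree_mem_wordLThree hp ha
  have hlen : 2 * k + 1 ≤ w.length := by
    have := two_mul_le_length_thetaPrefix p k
    simp only [hw, List.length_append, List.length_singleton]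
    omega
  have hΘw : ∃ F, 2 ≤ absVal F ∧ Θ = cfEval w F := by
    refine ⟨cfEval (-xDivThree p :: wordLNegOne p k) (thetaTail Θ (k + 1)), ?_, ?_⟩
    · refine two_le_absVal_cfEval (fun a ha => ?_) (absVal_thetaTail hp hΘ _).ge
      refine (natDegree_eq_of_degree_eq_some (degree_mem_thetaBlock hp (k := k) ?_)).ge
      rw [thetaBlock]
      exact List.mem_cons_of_mem _ (List.mem_append_right _ ha)
    · have h := hΘ.eq_cfEval (thetaPrefix p (k + 1)).length
      rw [map_range_thetaQuotients, thetaPrefix_succ, thetaBlock] at h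
      rw [← cfEval_append, hw, List.append_assoc, List.append_assoc]
      rw [thetaTail, thetaPrefix_succ, thetaBlock]
      exact h
  obtain ⟨F, hF, hΘF⟩ := hΘw
  obtain ⟨l, b, hlb⟩ : ∃ l b, w = l ++ [b] := by
    rcases List.eq_nil_or_concat w with h | ⟨l, b, h⟩
    · rw [h] at hlen; simp at hlen
    · exact ⟨l, b, by rw [h, List.concat_eq_append]⟩
  -- The entry q of w is the (1, 0) entry of l, which would be 0 for an empty l.
  obtain ⟨l', c, hlc⟩ : ∃ l' c, l = l' ++ [c] := by
    rcases List.eq_nil_or_concat l with h | ⟨l, b, h⟩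
    · rw [hlb, h] at hlen; simp at hlen; omega
    · exact ⟨l, b, by rw [h, List.concat_eq_append]⟩
  have hl : ∀ a ∈ l, a.degree = 1 := fun a ha => hdeg a (by rw [hlb]; simp [ha])
  have hb : b.degree = 1 := hdeg b (by rw [hlb]; simp)
  have hq0 : cfMatProd w 1 1 ≠ 0 := by
    rw [hlb, cfMatProd_concat_one_one]
    intro h
    have := (degree_cfMatProd_concat (l := l') (fun a ha => hl a (by rw [hlc]; simp [ha]))
      (hl c (by rw [hlc]; simp))).1
    rw [← hlc, h] at this
    simp at this
  refine ⟨cfMatProd w 1 1, hq0, ?_⟩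
  have h1 := absVal_mul_fracNorm_le_one hl hb hF
  rw [← hlb, ← hΘF] at h1
  have h2 : fracNorm (polyEmb (cfMatProd w 1 1) * Φ) ≤ 2 / 4 ^ k := by
    refine (fracNorm_le _ (cfMatProd w 1 0)).trans ?_
    rw [absVal_sub_comm, mul_comm, ← denomError, hw, wordLThree,
      absVal_denomError_append_replicate hp hΦ, div_le_div_iff₀ (by positivity) (by positivity)]
    have h3 := absVal_denomError_concat_le hp hΦ (l := thetaPrefix p k) (b := X)
      (fun a ha => degree_mem_thetaPrefix hp ha) degree_X
    have h4 := two_mul_length_thetaPrefix_le hp k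
    have h5 := two_mul_le_length_thetaPrefix p k
    -- In exponents of 2: ℓ + 2k ≤ p^k - 1, because 2k ≤ ℓ ≤ (p^k - 1)/2.
    have h6 : (2 : ℝ) ^ (thetaPrefix p k).length * 4 ^ k ≤ 4 ^ ((p ^ k - 1) / 2) := by
      rw [show (4 : ℝ) = 2 ^ 2 by norm_num, ← pow_mul, ← pow_mul, ← pow_add]
      exact pow_le_pow_right₀ (by norm_num) (by omega)
    have h7 : (0 : ℝ) < 4 ^ k := by positivity
    nlinarith
  exact (mul_le_mul h1 h2 (fracNorm_nonneg _) zero_le_one).trans_eq (one_mul _)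

theorem littlewood_theta_phi (hp : 5 ≤ p) (hΘ : HasContFrac Θ (thetaQuotients p))
    (hΦ : HasContFrac Φ (phiQuotients p)) : Littlewood Θ Φ := by
  have hnonneg : ∀ q : {q : (ZMod p)[X] // q ≠ 0}, 0 ≤ absVal (polyEmb q.1) *
      fracNorm (polyEmb q.1 * Θ) * fracNorm (polyEmb q.1 * Φ) := fun q =>
    mul_nonneg (mul_nonneg (absVal_nonneg _) (fracNorm_nonneg _)) (fracNorm_nonneg _)
  apply le_antisymm _ (Real.iInf_nonneg hnonneg)
  have hlim : Filter.Tendsto (fun n : ℕ => (2 : ℝ) / 4 ^ n) Filter.atTop (nhds 0) :=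
    tendsto_const_nhds.div_atTop (tendsto_pow_atTop_atTop_of_one_lt (by norm_num))
  refine ge_of_tendsto hlim (Filter.eventually_atTop.mpr ⟨1, fun k hk => ?_⟩)
  obtain ⟨q, hq, h⟩ := exists_littlewood_le hp hΘ hΦ k hk
  exact (ciInf_le ⟨0, by rintro _ ⟨q, rfl⟩; exact hnonneg q⟩ (⟨q, hq⟩ : {q : (ZMod p)[X] // q ≠ 0})).trans h

end LittlewoodProperty

/-! ### Pseudo-division and weighted leading forms of polynomials in X and Z. -/

section Weights

/-- Division with remainder after clearing denominators, so that coefficients stay in R. It makes a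
polynomial of least degree vanishing at Θ divide a multiple of the given one. -/
lemma exists_pseudo_div {R : Type*} [CommRing R] [IsDomain R] {A : R[X]} (hA : A ≠ 0) (f : R[X]) :
    ∃ c : R, c ≠ 0 ∧ ∃ B S : R[X], C c * f = A * B + S ∧ (S = 0 ∨ S.natDegree < A.natDegree) := by
  induction hn : f.natDegree using Nat.strong_induction_on generalizing f with
  | _ n ih =>
  subst hn
  by_cases hlt : f.natDegree < A.natDegree
  · exact ⟨1, one_ne_zero, 0, f, by simp, Or.inr hlt⟩
  rw [not_lt] at hlt
  rcases Nat.eq_zero_or_pos f.natDegree with h0 | hpos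
  · rw [h0, Nat.le_zero] at hlt
    obtain ⟨a, rfl⟩ := natDegree_eq_zero.mp hlt
    exact ⟨a, by simpa using hA, f, 0, by simp, Or.inl rfl⟩
  · obtain ⟨c, hc, B, S, h, hS⟩ := ih _
      (natDegree_cancelLeads_lt_of_natDegree_le_natDegree hlt hpos) _ rfl
    refine ⟨c * A.leadingCoeff, mul_ne_zero hc (leadingCoeff_ne_zero.mpr hA),
      B + C c * C f.leadingCoeff * X ^ (f.natDegree - A.natDegree), S, ?_, hS⟩
    rw [cancelLeads, Nat.sub_eq_zero_of_le hlt, pow_zero, mul_one] at h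
    rw [C_mul]
    linear_combination h

variable {R : Type*} [CommRing R]

/-- The homomorphism `X ↦ t ^ a`, `Z ↦ Z t ^ b`, from `R[X][Z]` to `R[Z][t]`. -/
noncomputable def weightHom (R : Type*) [CommRing R] (a b : ℕ) : R[X][X] →+* R[X][X] :=
  eval₂RingHom (eval₂RingHom (C.comp C) (X ^ a)) (C X * X ^ b)

lemma weightHom_monomial (a b n m : ℕ) (c : R) :
    weightHom R a b (monomial n (monomial m c)) = monomial (a * m + b * n) (monomial n c) := by
  simp only [weightHom, coe_eval₂RingHom, eval₂_monomial, RingHom.comp_apply]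
  rw [← C_mul_X_pow_eq_monomial, ← C_mul_X_pow_eq_monomial, C_mul, C_pow]
  ring

/-- The weight w and the exponent i of Z determine the exponent of X, so no two monomials collide.
Thus the leading coefficient in t is the leading form with X = 1. -/
lemma weightHom_coeff {a : ℕ} (ha : a ≠ 0) (b : ℕ) (A : R[X][X]) (w i : ℕ) :
    ((weightHom R a b A).coeff w).coeff i =
      if b * i ≤ w ∧ a ∣ w - b * i then (A.coeff i).coeff ((w - b * i) / a) else 0 := by
  induction A using Polynomial.induction_on' with
  | add A B hA hB =>
    rw [map_add, coeff_add, coeff_add, hA, hB, coeff_add, coeff_add]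
    split_ifs <;> simp
  | monomial n q =>
    induction q using Polynomial.induction_on' with
    | add q r hq hr =>
      rw [map_add (monomial n), map_add, coeff_add, coeff_add, hq, hr, coeff_add, coeff_add]
      split_ifs <;> simp
    | monomial m c =>
      rw [weightHom_monomial]
      simp only [coeff_monomial]
      by_cases hni : n = i
      · subst hni
        by_cases hw : a * m + b * n = w
        · subst hw
          simp [Nat.pos_of_ne_zero ha]
        · simp only [if_neg hw, coeff_zero, if_true]
          split_ifs with h
          · obtain ⟨h1, d, hd⟩ := h
            rw [hd, Nat.mul_div_cancel_left _ (Nat.pos_of_ne_zero ha), coeff_monomial, if_neg]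
            rintro rfl
            omega
          · rfl
      · split_ifs <;> simp [coeff_monomial, hni]

lemma exists_of_weightHom_coeff_ne_zero {a b : ℕ} (ha : a ≠ 0) {A : R[X][X]} {w i : ℕ}
    (h : ((weightHom R a b A).coeff w).coeff i ≠ 0) :
    ∃ j, a * j + b * i = w ∧ (A.coeff i).coeff j ≠ 0 := by
  rw [weightHom_coeff ha] at h
  split_ifs at h with hc
  · refine ⟨_, ?_, h⟩
    rw [Nat.mul_div_cancel' hc.2]
    omega
  · exact absurd rfl h

lemma weightHom_coeff_weight {a : ℕ} (ha : a ≠ 0) (b : ℕ) (A : R[X][X]) (i j : ℕ) :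
    ((weightHom R a b A).coeff (a * j + b * i)).coeff i = (A.coeff i).coeff j := by
  rw [weightHom_coeff ha]
  simp [Nat.pos_of_ne_zero ha]

lemma weight_le_natDegree {a : ℕ} (ha : a ≠ 0) (b : ℕ) {A : R[X][X]} {i : ℕ}
    (h : A.coeff i ≠ 0) :
    a * (A.coeff i).natDegree + b * i ≤ (weightHom R a b A).natDegree := by
  apply le_natDegree_of_ne_zero
  intro h0
  have := weightHom_coeff_weight ha b A i (A.coeff i).natDegree
  rw [h0, coeff_zero] at this
  exact h (leadingCoeff_eq_zero.mp this.symm)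

lemma weightHom_ne_zero {a : ℕ} (ha : a ≠ 0) (b : ℕ) {A : R[X][X]} (hA : A ≠ 0) :
    weightHom R a b A ≠ 0 := by
  intro h
  apply hA
  ext i j
  rw [← weightHom_coeff_weight ha b, h]
  simp

/-- If the leading form of `A` has a constant term, its degree is divisible by `a`. -/
lemma dvd_natDegree_leadingCoeff_weightHom {a b : ℕ} (ha : a ≠ 0) (hab : a.Coprime b)
    {A : R[X][X]} (h0 : (weightHom R a b A).leadingCoeff.coeff 0 ≠ 0) :
    a ∣ (weightHom R a b A).leadingCoeff.natDegree := by
  obtain ⟨j, hj, _⟩ := exists_of_weightHom_coeff_ne_zero ha h0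
  have hl : (weightHom R a b A).leadingCoeff.leadingCoeff ≠ 0 := by
    rw [leadingCoeff_ne_zero]
    rintro h; rw [h] at h0; simp at h0
  obtain ⟨k, hk, _⟩ := exists_of_weightHom_coeff_ne_zero ha hl
  -- The constant and the top monomial of the form have the same weight: a j = a k + b i, with i the
  -- degree in question.
  apply hab.dvd_of_dvd_mul_left
  rw [← Nat.dvd_add_right (Dvd.intro k rfl), hk, ← hj]
  simp

end Weights

/-! ### The degree of Θ is p + 1. -/

section Degree

variable {p : ℕ} [Fact p.Prime]

lemma mrPoly_coeff (hp : 5 ≤ p) (i : ℕ) : (mrPoly p).coeff i =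
    if i = p + 1 then X else if i = p then -(X ^ 2 - 3) else
    if i = 1 then X * mrF p (p - 2) - 3 * mrF p (p - 1) else
    if i = 0 then -(mrF p (p - 2) * (X ^ 2 - 3)) + 3 * mrF p (p - 1) * X else 0 := by
  rw [mrPoly]
  simp only [coeff_add, coeff_sub, coeff_C_mul, coeff_X_pow, coeff_X, coeff_C, @eq_comm _ 1 i]
  by_cases h1 : i = p + 1
  · subst h1; simp [show p ≠ 0 by omega]
  by_cases h2 : i = p
  · subst h2; simp [show i ≠ 0 by omega, show i ≠ 1 by omega]
  by_cases h3 : i = 1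
  · subst h3; simp [show p ≠ 0 by omega, show (1 : ℕ) ≠ p by omega]
  by_cases h4 : i = 0
  · subst h4; simp [h2]
  simp [h1, h2, h3, h4]

lemma natDegree_mrPoly (hp : 5 ≤ p) : (mrPoly p).natDegree = p + 1 := by
  apply le_antisymm
  · rw [natDegree_le_iff_coeff_eq_zero]
    intro i hi
    rw [mrPoly_coeff hp, if_neg (by omega), if_neg (by omega), if_neg (by omega),
      if_neg (by omega)]
  · apply le_natDegree_of_ne_zero
    rw [mrPoly_coeff hp, if_pos rfl]
    exact X_ne_zero

/-- The leading form of the polynomial, where `X` has weight `p` and `Z` has weight `p - 2`, has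
degree `p` and a constant term. -/
lemma weightHom_mrPoly (hp : 5 ≤ p) :
    (weightHom (ZMod p) p (p - 2) (mrPoly p)).leadingCoeff.coeff 0 ≠ 0 ∧
      (weightHom (ZMod p) p (p - 2) (mrPoly p)).leadingCoeff.natDegree = p := by
  have hp0 : p ≠ 0 := by omega
  obtain ⟨q, rfl⟩ : ∃ q, p = q + 2 := ⟨p - 2, by omega⟩
  obtain ⟨dg, mg⟩ := natDegree_mrF (q + 2) (q + 1)
  obtain ⟨dh, mh⟩ := natDegree_mrF (q + 2) q
  have hcoeff := mrPoly_coeff hp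
  simp only [show q + 2 - 1 = q + 1 by omega, Nat.add_sub_cancel] at hcoeff ⊢
  set g := mrF (q + 2) (q + 1)
  set h := mrF (q + 2) q
  have d3 : (3 : (ZMod (q + 2))[X]).natDegree = 0 := natDegree_ofNat 3
  have hd2 : (X ^ 2 - 3 : (ZMod (q + 2))[X]).natDegree ≤ 2 := by compute_degree
  have hd2' : (-(X ^ 2 - 3) : (ZMod (q + 2))[X]).natDegree ≤ 2 := by rwa [natDegree_neg]
  have hd0 : (-(h * (X ^ 2 - 3)) + 3 * g * X).natDegree ≤ q + 2 := by
    refine (natDegree_add_le _ _).trans (max_le ?_ ?_)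
    · rw [natDegree_neg]
      exact natDegree_mul_le.trans (by omega)
    · have h1 := natDegree_mul_le (p := 3 * g) (q := X)
      have h2 := natDegree_mul_le (p := 3) (q := g)
      rw [natDegree_X] at h1
      omega
  have hd1 : (X * h - 3 * g).natDegree ≤ q + 1 := by
    refine (natDegree_sub_le _ _).trans (max_le ?_ ?_)
    · have h1 := natDegree_mul_le (p := X) (q := h)
      rw [natDegree_X] at h1
      omega
    · exact natDegree_mul_le.trans (by omega)
  -- The monic h X² contributes -1 and 3 g X contributes 3.
  have hc0 : (-(h * (X ^ 2 - 3)) + 3 * g * X).coeff (q + 2) = 2 := by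
    have hh : h.coeff q = 1 := by have := mh.coeff_natDegree; rwa [dh] at this
    have hg : g.coeff (q + 1) = 1 := by have := mg.coeff_natDegree; rwa [dg] at this
    have hh2 : h.coeff (q + 2) = 0 := coeff_eq_zero_of_natDegree_lt (by omega)
    rw [show -(h * (X ^ 2 - 3)) + 3 * g * X = -(h * X ^ 2) + C 3 * h + C 3 * (g * X) by
      rw [map_ofNat]; ring]
    rw [coeff_add, coeff_add, coeff_neg, coeff_mul_X_pow, coeff_C_mul, coeff_C_mul,
      coeff_mul_X g (q + 1), hh, hg, hh2]
    norm_num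
  have h2 : (2 : ZMod (q + 2)) ≠ 0 := by
    intro h
    have h' : ((2 : ℕ) : ZMod (q + 2)) = 0 := by exact_mod_cast h
    rw [ZMod.natCast_eq_zero_iff] at h'
    exact absurd (Nat.le_of_dvd (by norm_num) h') (by omega)
  set P := weightHom (ZMod (q + 2)) (q + 2) q (mrPoly (q + 2)) with hP
  -- The coefficients of Z^p and of Z^0 reach weight p²; those of Z^(p+1) and Z stop at p² - 2.
  have hcase : ∀ w i, (P.coeff w).coeff i ≠ 0 → w ≤ (q + 2) ^ 2 ∧
      (w = (q + 2) ^ 2 → i ≤ q + 2) := by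
    intro w i hne
    obtain ⟨j, hj, hne⟩ := exists_of_weightHom_coeff_ne_zero hp0 hne
    have hjd := le_natDegree_of_ne_zero hne
    rw [hcoeff] at hjd hne
    split_ifs at hjd hne with e1 e2 e3 e4
    · rw [natDegree_X] at hjd
      subst e1
      constructor
      · nlinarith
      · intro hw
        nlinarith
    · subst e2
      exact ⟨by nlinarith, fun _ => le_rfl⟩
    · subst e3
      exact ⟨by nlinarith, fun _ => by omega⟩
    · subst e4
      exact ⟨by nlinarith, fun _ => by omega⟩
    · simp at hne
  have hP0 : (P.coeff ((q + 2) ^ 2)).coeff 0 = 2 := by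
    have := weightHom_coeff_weight hp0 q (mrPoly (q + 2)) 0 (q + 2)
    rw [hcoeff] at this
    simp only [hc0, show ¬ (0 = q + 2 + 1) by omega, show ¬ (0 = q + 2) by omega,
      show ¬ (0 = 1) by omega, if_false, if_true] at this
    rw [← this]
    congr 2
    ring
  have hPp : (P.coeff ((q + 2) ^ 2)).coeff (q + 2) = -1 := by
    have := weightHom_coeff_weight hp0 q (mrPoly (q + 2)) (q + 2) 2
    rw [hcoeff] at this
    rw [if_neg (by omega), if_pos rfl] at this
    rw [show (q + 2) ^ 2 = (q + 2) * 2 + q * (q + 2) by ring, hP, this]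
    rw [coeff_neg, coeff_sub, coeff_X_pow, if_pos rfl, coeff_ofNat_succ, sub_zero]
  have hdeg : P.natDegree = (q + 2) ^ 2 := by
    apply le_antisymm
    · rw [natDegree_le_iff_coeff_eq_zero]
      intro w hw
      ext i
      by_contra hne
      exact absurd (hcase w i (by simpa using hne)).1 (by omega)
    · apply le_natDegree_of_ne_zero
      intro h0
      rw [h0, coeff_zero] at hP0
      exact h2 hP0.symm
  rw [leadingCoeff, hdeg]
  refine ⟨by rwa [hP0], le_antisymm ?_ ?_⟩
  · rw [natDegree_le_iff_coeff_eq_zero]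
    intro i hi
    by_contra hne
    exact absurd ((hcase _ i hne).2 rfl) (by omega)
  · apply le_natDegree_of_ne_zero
    rw [hPp]
    exact neg_ne_zero.mpr one_ne_zero

lemma absVal_sum_lt {K ι : Type*} [Field K] {s : Finset ι} {f : ι → LaurentSeries K} {M : ℝ}
    (hM : 0 < M) (h : ∀ i ∈ s, absVal (f i) < M) : absVal (∑ i ∈ s, f i) < M := by
  classical
  induction s using Finset.induction_on with
  | empty => simpa [absVal_zero] using hM
  | insert i s hi ih =>
    rw [Finset.sum_insert hi]
    exact (absVal_add_le_max _ _).trans_lt (max_lt (h i (by simp))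
      (ih fun j hj => h j (by simp [hj])))

lemma eq_zero_of_natDegree_le_one {K : Type*} [Field K] {F : LaurentSeries K} {a : ℕ → K[X]}
    (hF : HasContFrac F a) (ha : ∀ n, (a n).natDegree = 1) {A : K[X][X]}
    (hA : A.natDegree ≤ 1) (h : A.eval₂ polyEmb F = 0) : A = 0 := by
  rw [eq_X_add_C_of_natDegree_le_one hA] at h ⊢
  simp only [eval₂_add, eval₂_mul, eval₂_C, eval₂_X] at h
  have h1 : A.coeff 1 = 0 := hF.not_rational ha (r := -A.coeff 0) (by
    rw [map_neg]; linear_combination h)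
  rw [h1, map_zero, zero_mul, zero_add, polyEmb_eq_zero] at h
  rw [h1, h]
  simp

theorem hasAlgDegree_theta (hp : 5 ≤ p) {Θ : LaurentSeries (ZMod p)}
    (hΘ : HasContFrac Θ (thetaQuotients p)) : HasAlgDegree Θ (p + 1) := by
  have hp0 : p ≠ 0 := by omega
  have hmr0 : mrPoly p ≠ 0 := ne_zero_of_natDegree_gt (n := 0) (by rw [natDegree_mrPoly hp]; omega)
  refine ⟨⟨mrPoly p, hmr0, mrPoly_eval hp hΘ, natDegree_mrPoly hp⟩, ?_⟩
  rintro n hn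
  classical
  have hex : ∃ n, n ∈ {n : ℕ | ∃ P : (ZMod p)[X][X], P ≠ 0 ∧ P.eval₂ polyEmb Θ = 0 ∧
    P.natDegree = n} := ⟨n, hn⟩
  refine le_trans ?_ (Nat.find_min' hex hn)
  obtain ⟨A, hA0, hAΘ, hAdeg⟩ := Nat.find_spec hex
  rw [← hAdeg]
  by_contra hlt
  rw [not_le] at hlt
  obtain ⟨c, hc, B, S, hdiv, hS⟩ := exists_pseudo_div hA0 (mrPoly p)
  -- The remainder also vanishes at Θ and has degree below the least one.
  have hS0 : S = 0 := by
    by_contra hS0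
    have hSΘ := congrArg (eval₂ polyEmb Θ) hdiv
    rw [eval₂_mul, mrPoly_eval hp hΘ, mul_zero, eval₂_add, eval₂_mul, hAΘ, zero_mul,
      zero_add] at hSΘ
    have := Nat.find_min' hex ⟨S, hS0, hSΘ.symm, rfl⟩
    rcases hS with h | h
    · exact hS0 h
    · omega
  rw [hS0, add_zero] at hdiv
  have hc' : (C c : (ZMod p)[X][X]) ≠ 0 := C_ne_zero.mpr hc
  have hB0 : B ≠ 0 := by
    rintro rfl
    rw [mul_zero] at hdiv
    exact mul_ne_zero hc' hmr0 hdiv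
  have hdegsum : p + 1 = A.natDegree + B.natDegree := by
    rw [← natDegree_mul hA0 hB0, ← hdiv, natDegree_C_mul hc, natDegree_mrPoly hp]
  obtain ⟨hl0, hlp⟩ := weightHom_mrPoly hp
  set ψ := weightHom (ZMod p) p (p - 2) with hψ
  have hlead := congrArg (fun P => (ψ P).leadingCoeff) hdiv
  simp only [map_mul, leadingCoeff_mul] at hlead
  have hψA := weightHom_ne_zero hp0 (p - 2) hA0
  have hψB := weightHom_ne_zero hp0 (p - 2) hB0
  have hψc : (ψ (C c)).leadingCoeff.natDegree = 0 := by
    rw [← Nat.le_zero, natDegree_le_iff_coeff_eq_zero]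
    intro i hi
    by_contra hne
    obtain ⟨j, _, hj⟩ := exists_of_weightHom_coeff_ne_zero hp0 hne
    rw [coeff_C, if_neg (by omega)] at hj
    simp at hj
  have hψc0 : (ψ (C c)).leadingCoeff ≠ 0 :=
    leadingCoeff_ne_zero.mpr (weightHom_ne_zero hp0 (p - 2) hc')
  have hcop : p.Coprime (p - 2) :=
    ((Fact.out : p.Prime).coprime_iff_not_dvd).mpr fun h =>
      absurd (Nat.le_of_dvd (by omega) h) (by omega)
  have hl0' : (ψ A).leadingCoeff.coeff 0 * (ψ B).leadingCoeff.coeff 0 ≠ 0 := by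
    rw [← mul_coeff_zero, ← hlead, mul_coeff_zero]
    refine mul_ne_zero ?_ hl0
    obtain ⟨γ, hγ⟩ := natDegree_eq_zero.mp hψc
    rw [← hγ] at hψc0 ⊢
    rw [coeff_C_zero]
    exact C_ne_zero.mp hψc0
  have hdA := dvd_natDegree_leadingCoeff_weightHom hp0 hcop (left_ne_zero_of_mul hl0')
  have hsum : p = (ψ A).leadingCoeff.natDegree + (ψ B).leadingCoeff.natDegree := by
    rw [← natDegree_mul (leadingCoeff_ne_zero.mpr hψA) (leadingCoeff_ne_zero.mpr hψB), ← hlead,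
      natDegree_mul hψc0 (by rintro h; rw [h] at hl0; simp at hl0), hψc, zero_add, hlp]
  obtain ⟨d, hd⟩ := hdA
  rw [← hψ] at hd
  -- The leading forms of A and B have degrees in Z with sum p, and that of A is a multiple of p: it
  -- is 0 or p.
  rcases Nat.eq_zero_or_pos d with rfl | hdpos
  · have hBp : (ψ B).leadingCoeff.natDegree = p := by omega
    have hl : (ψ B).leadingCoeff.leadingCoeff ≠ 0 :=
      leadingCoeff_ne_zero.mpr (leadingCoeff_ne_zero.mpr hψB)
    rw [leadingCoeff, hBp] at hl
    obtain ⟨j, _, hj⟩ := exists_of_weightHom_coeff_ne_zero hp0 hl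
    have hBdeg : p ≤ B.natDegree := by
      apply le_natDegree_of_ne_zero
      rintro h; rw [h] at hj; simp at hj
    exact hA0 (eq_zero_of_natDegree_le_one hΘ (natDegree_thetaQuotients hp) (by omega) hAΘ)
  · have hAp : (ψ A).leadingCoeff.natDegree = p := by nlinarith
    have hl : (ψ A).leadingCoeff.leadingCoeff ≠ 0 :=
      leadingCoeff_ne_zero.mpr (leadingCoeff_ne_zero.mpr hψA)
    rw [leadingCoeff, hAp] at hl
    obtain ⟨j, hjw, hj⟩ := exists_of_weightHom_coeff_ne_zero hp0 hl
    have hApne : A.coeff p ≠ 0 := by rintro h; rw [h] at hj; simp at hj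
    have hjd := le_natDegree_of_ne_zero hj
    have hAle := le_natDegree_of_ne_zero hApne
    have hAdeg' : A.natDegree = p := by omega
    have hΘ2 : absVal Θ = 2 := absVal_thetaTail hp hΘ 0
    have hterm : ∀ i, A.coeff i ≠ 0 →
        absVal (polyEmb (A.coeff i) * Θ ^ i) = 2 ^ ((A.coeff i).natDegree + i) := by
      intro i hi
      rw [absVal_mul, absVal_pow, hΘ2, absVal_polyEmb hi, pow_add]
    have hsumA := hAΘ
    rw [eval₂_eq_sum_range, hAdeg', Finset.sum_range_succ, add_comm] at hsumA
    have hpos : (0 : ℝ) < absVal (polyEmb (A.coeff p) * Θ ^ p) := by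
      rw [hterm p hApne]; positivity
    have hsmall : absVal (∑ i ∈ Finset.range p, polyEmb (A.coeff i) * Θ ^ i) <
        absVal (polyEmb (A.coeff p) * Θ ^ p) := by
      refine absVal_sum_lt hpos fun i hi => ?_
      rw [Finset.mem_range] at hi
      by_cases hi0 : A.coeff i = 0
      · rw [hi0, map_zero, zero_mul, absVal_zero]; exact hpos
      · rw [hterm i hi0, hterm p hApne]
        apply pow_lt_pow_right₀ (by norm_num)
        -- For i < p, the bound p d_i + (p-2) i ≤ p j + (p-2) p on weights gives d_i + i < j + p:
        -- the Z^p term has the strictly largest norm, because |Θ| = 2.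
        have hw := weight_le_natDegree hp0 (p - 2) hi0
        rw [← hψ, ← hjw] at hw
        obtain ⟨q, rfl⟩ : ∃ q, p = q + 2 := ⟨p - 2, by omega⟩
        simp only [Nat.add_sub_cancel] at hw
        by_contra hcon
        rw [not_lt] at hcon
        nlinarith
    have := absVal_add_eq_left hsmall
    rw [hsumA, absVal_zero] at this
    exact hpos.ne this

end Degree

/-! ### Degree of Φ, linear independence, and the theorem. -/

section Main

variable {p : ℕ} [Fact p.Prime] {Θ Φ : LaurentSeries (ZMod p)}

theorem hasAlgDegree_phi (hp : 5 ≤ p) (hΦ : HasContFrac Φ (phiQuotients p)) :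
    HasAlgDegree Φ 2 := by
  constructor
  · have hdeg : (X ^ 2 - C (3 * X) * X - C 9 : (ZMod p)[X][X]).natDegree = 2 := by
      compute_degree!
    refine ⟨X ^ 2 - C (3 * X) * X - C 9, ne_zero_of_natDegree_gt (n := 1) (by omega), ?_, hdeg⟩
    simp only [eval₂_sub, eval₂_mul, eval₂_pow, eval₂_X, eval₂_C, map_ofNat polyEmb]
    exact phi_sq hp hΦ
  · rintro n ⟨A, hA0, hA, rfl⟩
    by_contra hlt
    exact hA0 (eq_zero_of_natDegree_le_one hΦ (natDegree_phiQuotients hp) (by omega) hA)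

theorem oneLinIndep_theta_phi (hp : 5 ≤ p) (hΘ : HasContFrac Θ (thetaQuotients p))
    (hΦ : HasContFrac Φ (phiQuotients p)) : OneLinIndep Θ Φ := by
  intro a b c h
  have hb : b = 0 := by
    by_contra hb
    -- Put cΦ = -(a + bΘ) into c² (Φ² - 3XΦ - 9) = 0.
    set A : (ZMod p)[X][X] := C (b ^ 2) * X ^ 2 + C (2 * a * b + 3 * X * c * b) * X +
      C (a ^ 2 + 3 * X * c * a - 9 * c ^ 2) with hA
    have hdeg : A.natDegree = 2 := natDegree_quadratic (pow_ne_zero 2 hb)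
    have hA0 : A ≠ 0 := ne_zero_of_natDegree_gt (n := 1) (by omega)
    have heval : A.eval₂ polyEmb Θ = 0 := by
      have hsq := phi_sq hp hΦ
      simp only [hA, eval₂_add, eval₂_mul, eval₂_pow, eval₂_X, eval₂_C]
      simp only [map_add, map_sub, map_mul, map_pow, map_ofNat] at hsq ⊢
      linear_combination (polyEmb a + polyEmb b * Θ - polyEmb c * Φ +
        3 * polyEmb X * polyEmb c) * h + polyEmb c ^ 2 * hsq
    have := (hasAlgDegree_theta hp hΘ).2 ⟨A, hA0, heval, rfl⟩
    omega
  rw [hb, map_zero, zero_mul, add_zero] at h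
  have hc : c = 0 := hΦ.not_rational (natDegree_phiQuotients hp) (r := -a) (by
    rw [map_neg]; linear_combination h)
  rw [hc, map_zero, zero_mul, add_zero, polyEmb_eq_zero] at h
  exact ⟨h, hb, hc⟩

end Main

theorem theorem8 (p : ℕ) [Fact p.Prime] (hp : 5 ≤ p) :
    ∃ Θ Φ : LaurentSeries (ZMod p),
      (∀ F : LaurentSeries (ZMod p), HasContFrac F (thetaQuotients p) ↔ F = Θ) ∧
      (∀ F : LaurentSeries (ZMod p), HasContFrac F (phiQuotients p) ↔ F = Φ) ∧
      (mrPoly p).eval₂ polyEmb Θ = 0 ∧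
      HasAlgDegree Θ (p + 1) ∧
      HasAlgDegree Φ 2 ∧
      LittlewoodNontrivially Θ Φ := by
  have dΘ := natDegree_thetaQuotients hp
  have dΦ := natDegree_phiQuotients hp
  obtain ⟨Θ, hΘ⟩ := exists_hasContFrac fun n => (dΘ n).ge
  obtain ⟨Φ, hΦ⟩ := exists_hasContFrac fun n => (dΦ n).ge
  refine ⟨Θ, Φ, fun F => ⟨fun h => h.unique hΘ fun n => (dΘ n).ge, ?_⟩,
    fun F => ⟨fun h => h.unique hΦ fun n => (dΦ n).ge, ?_⟩, mrPoly_eval hp hΘ,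
    hasAlgDegree_theta hp hΘ, hasAlgDegree_phi hp hΦ, littlewood_theta_phi hp hΘ hΦ,
    hΘ.badlyApproximable dΘ, hΦ.badlyApproximable dΦ, oneLinIndep_theta_phi hp hΘ hΦ⟩
  · rintro rfl; exact hΘ
  · rintro rfl; exact hΦ
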